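/- Let $k>d\ge 1$ be integers. Cut and project sets: let $E\subseteq\mathbb{R}^k$ be a $d$-dimensional subspace, $F_\pi$ a complementary subspace, $\pi:\mathbb{R}^k\to E$ the projection along $F_\pi$, assumed injective on $\mathbb{Z}^k$; let $\mathcal{W}_\pi\subseteq F_\pi$, $\mathcal{S}=\mathcal{W}_\pi+E$, $s\in\mathbb{R}^k$. The associated $k$ to $d$ cut and project set is $Y=\pi(\mathcal{S}\cap(\mathbb{Z}^k+s))\subseteq E$, and for $y\in Y$ we let $\tilde y\in\mathbb{Z}^k$ be the unique point with $\pi(\tilde y+s)=y$. Put $F_\rho=\{0\}\times\mathbb{R}^{k-d}$. We assume that $E$ is complementary to $F_\rho$, and denote by $\rho:\mathbb{R}^k\to E$ the projection along $F_\rho$. The set $Y$ is called cubical if - $\mathbb{Z}^k+s$ does not meet $\partial\mathcal{S}$, - the image of $E$ in $\mathbb{R}^k/\mathbb{Z}^k$ is dense, - the only $x\in E$ with $Y+x=Y$ is $x=0$, and - $\mathcal{S}\cap F_\rho=\{\sum_{i=d+1}^k t_ie_i: 0\le t_i<1\}$. Linear repetitivity: identify $\mathbb{R}^d$ with $\langle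 e_1,\dots,e_d\rangle\subseteq\mathbb{R}^k$. For $\Omega\subseteq\mathbb{R}^d$ and $y\in Y$ let $P(y,\Omega)=\{y'\in Y:\rho(\tilde y'-\tilde y)\in\rho(\Omega)\}$. For a collection $\mathcal{A}$ of bounded measurable subsets of $\mathbb{R}^d$, $Y$ is LR with respect to $\mathcal{A}$ if there is $C>0$ such that for every $\Omega\in\mathcal{A}$, every $y\in Y$ and every sup-norm ball $B\subseteq\mathbb{R}^d$ of volume $C|\Omega|$ there is $y'\in Y\cap\rho(B)$ with $P(y,\Omega)=P(y',\Omega)+y-y'$. Let $\mathcal{R}_d$ be the collection of all rectangles $\prod_{i=1}^d[a_i,b_i]$ with integers $a_i<b_i$ that contain the origin, i.e. $a_i\le 0\le b_i$ for all $i$. Theorem. If $k-d>1$, then no $k$ to $d$ cubical cut and project set is LR with respect to $\mathcal{R}_d$. If $k-d=1$, then the following are equivalent: (C1) There is a $k$ to $d$ cubical cut and project set which is LR with respect to $\mathcal{R}_d$. (C2) There are real numbers $\alpha_1,\dots,\alpha_d$ with $\liminf_{n\to\infty} n\|n\alpha_1\|\cdots\|n\alpha_d\|>0$, where $\|x\|$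 denotes the distance from $x\in\mathbb{R}$ to the nearest integer. -/

import Mathlib

open scoped Pointwise

noncomputable section

namespace CutProject

/-- The image of an integer vector in `ℝ^k`. -/
def intVec {k : ℕ} (n : Fin k → ℤ) : Fin k → ℝ := fun i => (n i : ℝ)

/-- The reference subspace `{0} × ℝ^{k-d}` of `ℝ^k`. -/
def refSubspace (k d : ℕ) : Submodule ℝ (Fin k → ℝ) where
  carrier := {v | ∀ i : Fin k, (i : ℕ) < d → v i = 0}
  add_mem' := by
    intro a b ha hb i hi
    simp [ha i hi, hb i hi]
  zero_mem' := by
    intro i _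
    rfl
  smul_mem' := by
    intro c v hv i hi
    simp [hv i hi]

/-- The identification of `ℝ^d` with the span of the first `d` standard basis vectors of `ℝ^k`. -/
def embed (k d : ℕ) (x : Fin d → ℝ) : Fin k → ℝ :=
  fun i => if h : (i : ℕ) < d then x ⟨i, h⟩ else 0

/-- The cubical window `{∑_{d < i ≤ k} tᵢ eᵢ : 0 ≤ tᵢ < 1}` in the reference subspace. -/
def cubicalWindow (k d : ℕ) : Set (Fin k → ℝ) :=
  {v | ∀ i : Fin k, ((i : ℕ) < d → v i = 0) ∧ (d ≤ (i : ℕ) → 0 ≤ v i ∧ v i < 1)}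

/-- The data defining a `k` to `d` cut and project set: a `d`-dimensional subspace `E` of `ℝ^k`,
a complement `F` of `E` along which one projects, a window in `F`, and a translation vector `s`
(a representative of a class in `ℝ^k / ℤ^k`). The projection to `E` along `F` is injective on
`ℤ^k`. Moreover `E` is complementary to the reference subspace `{0} × ℝ^{k-d}`, that is, `E` is the
graph of a linear map `ℝ^d → ℝ^{k-d}`; this is needed for the projection `rho` below to make sense,
and it is automatic if the window is cubical, because the cubical window is bounded. -/
structure Data (k d : ℕ) where
  E : Submodule ℝ (Fin k → ℝ)
  finrank_E : Module.finrank ℝ E = d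
  F : Submodule ℝ (Fin k → ℝ)
  isCompl : IsCompl E F
  isCompl_ref : IsCompl E (refSubspace k d)
  window : Set (Fin k → ℝ)
  window_subset : window ⊆ F
  s : Fin k → ℝ
  injective : Function.Injective fun n : Fin k → ℤ => E.projection F isCompl (intVec n)

namespace Data

variable {k d : ℕ} (D : Data k d)

/-- The projection onto `E` along `F`. -/
def proj : (Fin k → ℝ) →ₗ[ℝ] (Fin k → ℝ) := D.E.projection D.F D.isCompl

/-- The projection onto `E` along the reference subspace. -/
def rho : (Fin k → ℝ) →ₗ[ℝ] (Fin k → ℝ) := D.E.projection (refSubspace k d) D.isCompl_ref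

/-- The strip: the Minkowski sum of the window and `E`. -/
def strip : Set (Fin k → ℝ) := D.window + (D.E : Set (Fin k → ℝ))

/-- The integer points `n` for which `n + s` lies in the strip and projects to `y`. For a point `y`
of the cut and project set there is exactly one such `n`, since the projection is injective on
`ℤ^k`. -/
def IsLift (n : Fin k → ℤ) (y : Fin k → ℝ) : Prop :=
  intVec n + D.s ∈ D.strip ∧ D.proj (intVec n + D.s) = y

/-- The cut and project set `Y = π(𝓢 ∩ (ℤ^k + s))`, a subset of `E`. -/
def pointSet : Set (Fin k → ℝ) :=
  D.proj '' (D.strip ∩ {v | ∃ n : Fin k → ℤ, v = intVec n + D.s})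

/-- `ℤ^k + s` does not meet the boundary of the strip. -/
def IsRegular : Prop := ∀ n : Fin k → ℤ, intVec n + D.s ∉ frontier D.strip

/-- The image of `E` in the torus `ℝ^k / ℤ^k` is dense. -/
def IsTotallyIrrational : Prop :=
  Dense ((fun (v : Fin k → ℝ) => ((fun i => (v i : UnitAddCircle)) : UnitAddTorus (Fin k))) ''
    (D.E : Set (Fin k → ℝ)))

/-- The only `x ∈ E` with `Y + x = Y` is `0`. -/
def IsAperiodic : Prop := ∀ x ∈ D.E, (fun y => y + x) '' D.pointSet = D.pointSet → x = 0

/-- Cubical cut and project sets: regular, totally irrational and aperiodic, and the strip meets the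
reference subspace in the cubical window. -/
def IsCubical : Prop :=
  D.IsRegular ∧ D.IsTotallyIrrational ∧ D.IsAperiodic ∧
    D.strip ∩ (refSubspace k d : Set (Fin k → ℝ)) = cubicalWindow k d

/-- The patch of shape `Ω` at `y`: all `y' ∈ Y` such that the difference of the lifts of `y'` and
`y` has its `rho`-projection in `rho(Ω)`. -/
def patch (y : Fin k → ℝ) (Ω : Set (Fin d → ℝ)) : Set (Fin k → ℝ) :=
  {y' | y' ∈ D.pointSet ∧ ∃ n n' : Fin k → ℤ, D.IsLift n y ∧ D.IsLift n' y' ∧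
    D.rho (intVec n' - intVec n) ∈ D.rho '' (embed k d '' Ω)}

/-- The patches of shape `Ω` at `y₁` and `y₂` agree up to the translation from `y₂` to `y₁`. -/
def PatchEquiv (Ω : Set (Fin d → ℝ)) (y₁ y₂ : Fin k → ℝ) : Prop :=
  D.patch y₁ Ω = (fun z => z + (y₁ - y₂)) '' D.patch y₂ Ω

/-- Linear repetitivity with respect to a collection `𝓐` of shapes in `ℝ^d`: for some `C > 0`, every
patch of shape `Ω ∈ 𝓐` recurs, up to equivalence, at a distinguished point in (the image in `E` of)
every ball of volume `C |Ω|` in `ℝ^d`. Balls are taken in the sup norm. -/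
def IsLRWith (𝓐 : Set (Set (Fin d → ℝ))) : Prop :=
  ∃ C : ℝ, 0 < C ∧ ∀ Ω ∈ 𝓐, ∀ y ∈ D.pointSet, ∀ (x : Fin d → ℝ) (r : ℝ),
    MeasureTheory.volume (Metric.ball x r) = ENNReal.ofReal C * MeasureTheory.volume Ω →
      ∃ y' ∈ D.pointSet, y' ∈ D.rho '' (embed k d '' Metric.ball x r) ∧ D.PatchEquiv Ω y y'

end Data

/-- The aligned rectangles in `ℝ^d` with integer vertices and non-empty interior that contain the
origin (so that a patch contains its distinguished point). -/
def alignedRectangles (d : ℕ) : Set (Set (Fin d → ℝ)) :=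
  {Ω | ∃ a b : Fin d → ℤ, (∀ i, a i < b i) ∧ (∀ i, a i ≤ 0 ∧ 0 ≤ b i) ∧
    Ω = Set.Icc (intVec a) (intVec b)}

/-- The distance from a real number to the nearest integer. -/
def distInt (x : ℝ) : ℝ := |x - round x|

end CutProject

end

/-! Write `E` as the graph of linear forms `L_j` on `ℝ^d`, one for each of the last `k - d`
coordinates. The cubical window makes exactly one lattice point of the strip lie over each `m ∈
ℤ^d`, so `Y` is indexed by `ℤ^d`. The patch of a rectangle `Ω` at `m` is determined by the numbers
`⌊w_j(m) - L_j(u)⌋`, `u ∈ Ω ∩ ℤ^d`, where `w_j(m)` is the fractional part of `offset_j - L_j(m)`.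
The hyperplanes `w_j = {L_j(u)}` thus cut the window into boxes, and a patch is a box. Linear
repetitivity says that for rectangles of volume `l ^ d` every nonempty box is visited from each cube
of radius `O(l)` (`exists_recursWith`, `isLRWith_of_recursWith`).

In codimension above one, long thin rectangles `M^d × 1 × ⋯ × 1` violate this: only `O(M^d)` points
lie within `O(M)`. If a column of the coefficient matrix is irrational in two rows, there are more
than `M^(2d)` boxes. If a row has both a rational and an irrational entry, there are more than `M^d`
arcs but only `O(M^(d-1))` phases. Total irrationality forces one of the two.

In codimension one there is a single form with coefficients `α`, and boxes are arcs. Recurrence of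
an arc of length `δ` at scale `l` forces `δ ≫ l ^ (-d)`, and for the rectangle spanned by `0` and
`u` this says that `α` is a multiplicatively badly approximable linear form. Conversely, bad
approximability keeps all arcs long, and a pigeonhole argument for inhomogeneous approximation
(`exists_near`) reaches each of them in time. A multiplicative transference principle, proved in
both directions by pigeonhole, exchanges the linear form for the product in (C2). For existence, the
graph of the form carries a cubical cut and project set. -/

noncomputable section

namespace CutProject

/-! ### The internal coordinates of a cut and project set -/

/-- The first `d` coordinates of a vector. -/
def head {k d : ℕ} (h : d ≤ k) {R : Type*} (v : Fin k → R) : Fin d → R :=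
  fun i => v (Fin.castLE h i)

/-- `embed` as a linear map. -/
def embedLin (k d : ℕ) : (Fin d → ℝ) →ₗ[ℝ] (Fin k → ℝ) where
  toFun := embed k d
  map_add' x y := by
    funext i
    by_cases h : (i : ℕ) < d <;> simp [embed, h]
  map_smul' c x := by
    funext i
    by_cases h : (i : ℕ) < d <;> simp [embed, h]

lemma embedLin_apply (k d : ℕ) (x : Fin d → ℝ) : embedLin k d x = embed k d x := rfl

lemma embed_of_lt {k d : ℕ} (x : Fin d → ℝ) {i : Fin k} (h : (i : ℕ) < d) :
    embed k d x i = x ⟨i, h⟩ := by simp [embed, h]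

lemma embed_castLE {k d : ℕ} (h : d ≤ k) (x : Fin d → ℝ) (i : Fin d) :
    embed k d x (Fin.castLE h i) = x i := by simp [embed]

lemma head_of_lt {k d : ℕ} (h : d ≤ k) {R : Type*} (v : Fin k → R) {i : Fin k}
    (hi : (i : ℕ) < d) : head h v ⟨i, hi⟩ = v i := rfl

lemma intVec_add {k : ℕ} (m n : Fin k → ℤ) : intVec (m + n) = intVec m + intVec n := by
  funext i; simp [intVec]

lemma intVec_sub {k : ℕ} (m n : Fin k → ℤ) : intVec (m - n) = intVec m - intVec n := by
  funext i; simp [intVec]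

lemma intVec_zero {k : ℕ} : intVec (0 : Fin k → ℤ) = 0 := by
  funext i; simp [intVec]

lemma intVec_injective {k : ℕ} : Function.Injective (intVec : (Fin k → ℤ) → Fin k → ℝ) := by
  intro m n h
  funext i
  have := congrFun h i
  simpa [intVec] using this

lemma head_intVec {k d : ℕ} (h : d ≤ k) (n : Fin k → ℤ) :
    head h (intVec n) = intVec (head h n) := rfl

lemma head_add {k d : ℕ} (h : d ≤ k) (v w : Fin k → ℝ) :
    head h (v + w) = head h v + head h w := rfl

namespace Data

variable {k d : ℕ} (D : Data k d)

/-- The `j`-th coordinate of the linear map whose graph is `E`. -/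
def slope (j : Fin k) : (Fin d → ℝ) →ₗ[ℝ] ℝ :=
  LinearMap.proj j ∘ₗ D.rho ∘ₗ embedLin k d

lemma rho_mem (v : Fin k → ℝ) : D.rho v ∈ D.E :=
  Submodule.projection_apply_mem D.isCompl_ref v

lemma rho_of_mem {v : Fin k → ℝ} (hv : v ∈ D.E) : D.rho v = v :=
  Submodule.projection_apply_of_mem_left D.isCompl_ref hv

lemma sub_rho_mem (v : Fin k → ℝ) : v - D.rho v ∈ refSubspace k d :=
  Submodule.sub_projection_mem D.isCompl_ref v

lemma rho_of_mem_ref {v : Fin k → ℝ} (hv : v ∈ refSubspace k d) : D.rho v = 0 :=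
  (Submodule.projection_apply_eq_zero_iff D.isCompl_ref).2 hv

lemma rho_apply_of_lt (v : Fin k → ℝ) {i : Fin k} (hi : (i : ℕ) < d) : D.rho v i = v i := by
  have := D.sub_rho_mem v i hi
  simp only [Pi.sub_apply] at this
  linarith

lemma rho_embed_head (h : d ≤ k) (v : Fin k → ℝ) :
    D.rho (embed k d (head h v)) = D.rho v := by
  have : v - embed k d (head h v) ∈ refSubspace k d := by
    intro i hi
    simp [embed_of_lt _ hi, head_of_lt h v hi]
  have := D.rho_of_mem_ref this
  rw [map_sub, sub_eq_zero] at this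
  exact this.symm

lemma rho_apply (h : d ≤ k) (v : Fin k → ℝ) (j : Fin k) :
    D.rho v j = D.slope j (head h v) := by
  simp only [slope, LinearMap.comp_apply, embedLin_apply, LinearMap.proj_apply, rho_embed_head]

lemma mem_E_iff (h : d ≤ k) (v : Fin k → ℝ) :
    v ∈ D.E ↔ ∀ j : Fin k, d ≤ (j : ℕ) → v j = D.slope j (head h v) := by
  constructor
  · intro hv j _
    rw [← D.rho_apply h, D.rho_of_mem hv]
  · intro hv
    have : D.rho v = v := by
      funext j
      by_cases hj : (j : ℕ) < d
      · exact D.rho_apply_of_lt v hj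
      · rw [D.rho_apply h, hv j (not_lt.1 hj)]
    rw [← this]
    exact D.rho_mem v

lemma add_mem_strip_iff {v x : Fin k → ℝ} (hx : x ∈ D.E) : v + x ∈ D.strip ↔ v ∈ D.strip := by
  constructor
  · rintro ⟨w, hw, e, he, hwe⟩
    refine ⟨w, hw, e - x, D.E.sub_mem he hx, ?_⟩
    rw [← add_sub_cancel_right v x, ← hwe]
    simp [add_sub_assoc]
  · rintro ⟨w, hw, e, he, hwe⟩
    refine ⟨w, hw, e + x, D.E.add_mem he hx, ?_⟩
    rw [← hwe]
    simp [add_assoc]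

/-- The strip is invariant under `E`, so membership can be tested after sliding along `E` into the
reference subspace. The original window and `F` then play no role. -/
lemma mem_strip_iff_sub_rho_mem
    (hc : D.strip ∩ (refSubspace k d : Set (Fin k → ℝ)) = cubicalWindow k d)
    (v : Fin k → ℝ) : v ∈ D.strip ↔ v - D.rho v ∈ cubicalWindow k d := by
  rw [← hc, Set.mem_inter_iff, sub_eq_add_neg,
    D.add_mem_strip_iff (D.E.neg_mem (D.rho_mem v)), ← sub_eq_add_neg]
  exact ⟨fun h => ⟨h, D.sub_rho_mem v⟩, fun h => h.1⟩

lemma mem_strip_iff (h : d ≤ k)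
    (hc : D.strip ∩ (refSubspace k d : Set (Fin k → ℝ)) = cubicalWindow k d)
    (v : Fin k → ℝ) : v ∈ D.strip ↔ ∀ j : Fin k, d ≤ (j : ℕ) →
      0 ≤ v j - D.slope j (head h v) ∧ v j - D.slope j (head h v) < 1 := by
  rw [D.mem_strip_iff_sub_rho_mem hc]
  simp only [cubicalWindow, Set.mem_ofPred_eq, Pi.sub_apply, ← D.rho_apply h]
  constructor
  · exact fun hv j hj => (hv j).2 hj
  · exact fun hv j => ⟨fun hj => by rw [D.rho_apply_of_lt v hj, sub_self], hv j⟩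

/-- On the strip, the projection onto `E` moves the first coordinates by a bounded amount. -/
lemma exists_proj_bound
    (hc : D.strip ∩ (refSubspace k d : Set (Fin k → ℝ)) = cubicalWindow k d) :
    ∃ K : ℝ, 0 ≤ K ∧ ∀ v ∈ D.strip, ∀ i : Fin k, (i : ℕ) < d → |D.proj v i - v i| ≤ K := by
  set p := LinearMap.toContinuousLinearMap D.proj with hp
  refine ⟨‖p‖, norm_nonneg _, fun v hv i hi => ?_⟩
  rw [D.mem_strip_iff_sub_rho_mem hc] at hv
  have h1 : ‖v - D.rho v‖ ≤ 1 := by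
    refine (pi_norm_le_iff_of_nonneg zero_le_one).2 fun j => ?_
    by_cases hj : (j : ℕ) < d
    · rw [(hv j).1 hj]; simp
    · obtain ⟨h0, h1⟩ := (hv j).2 (not_lt.1 hj)
      rw [Real.norm_of_nonneg h0]; exact h1.le
  have h2 : D.proj v i - v i = p (v - D.rho v) i := by
    have : D.proj (D.rho v) = D.rho v :=
      Submodule.projection_apply_of_mem_left D.isCompl (D.rho_mem v)
    simp only [hp, LinearMap.coe_toContinuousLinearMap', map_sub, this, Pi.sub_apply,
      D.rho_apply_of_lt v hi]
  rw [h2, ← Real.norm_eq_abs]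
  refine (norm_le_pi_norm _ i).trans ((p.le_opNorm _).trans ?_)
  exact mul_le_of_le_one_right (norm_nonneg _) h1

/-- The `j`-th internal coordinate of the translation vector. -/
def offset (h : d ≤ k) (j : Fin k) : ℝ := D.s j - D.slope j (head h D.s)

/-- The `j`-th internal coordinate of the point of the cut and project set over `m`. -/
def phase (h : d ≤ k) (j : Fin k) (m : Fin d → ℤ) : ℝ :=
  Int.fract (D.offset h j - D.slope j (intVec m))

/-- The unique integer point over `m ∈ ℤ^d` whose translate by `s` lies in the strip. -/
def liftOf (h : d ≤ k) (m : Fin d → ℤ) : Fin k → ℤ :=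
  fun i => if hi : (i : ℕ) < d then m ⟨i, hi⟩ else -⌊D.offset h i - D.slope i (intVec m)⌋

/-- The point of the cut and project set over `m ∈ ℤ^d`. -/
def pointOf (h : d ≤ k) (m : Fin d → ℤ) : Fin k → ℝ := D.proj (intVec (D.liftOf h m) + D.s)

lemma head_liftOf (h : d ≤ k) (m : Fin d → ℤ) : head h (D.liftOf h m) = m := by
  funext i
  simp [head, liftOf]

lemma head_liftOf_sub (h : d ≤ k) (m m' : Fin d → ℤ) :
    head h (D.liftOf h m' - D.liftOf h m) = m' - m := by
  funext i
  simp [head, liftOf]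

lemma liftOf_of_le (h : d ≤ k) (m : Fin d → ℤ) {j : Fin k} (hj : d ≤ (j : ℕ)) :
    D.liftOf h m j = -⌊D.offset h j - D.slope j (intVec m)⌋ := by
  simp [liftOf, not_lt.2 hj]

/-- Each remaining internal coordinate must lie in `[0, 1)`, which leaves exactly one integer, given
by a floor. This is what indexes `Y` by `ℤ^d`. -/
lemma intVec_add_s_mem_strip_iff (h : d ≤ k)
    (hc : D.strip ∩ (refSubspace k d : Set (Fin k → ℝ)) = cubicalWindow k d)
    (n : Fin k → ℤ) : intVec n + D.s ∈ D.strip ↔ n = D.liftOf h (head h n) := by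
  rw [D.mem_strip_iff h hc]
  have key : ∀ j : Fin k, d ≤ (j : ℕ) →
      ((0 ≤ (intVec n + D.s) j - D.slope j (head h (intVec n + D.s)) ∧
        (intVec n + D.s) j - D.slope j (head h (intVec n + D.s)) < 1) ↔
        n j = D.liftOf h (head h n) j) := by
    intro j hj
    rw [D.liftOf_of_le h _ hj, eq_comm, neg_eq_iff_eq_neg, Int.floor_eq_iff, head_add,
      head_intVec, map_add, offset, Pi.add_apply]
    simp only [intVec]
    push_cast
    constructor <;> rintro ⟨h1, h2⟩ <;> constructor <;> linarith
  constructor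
  · intro H
    funext j
    by_cases hj : (j : ℕ) < d
    · simp [liftOf, hj, head_of_lt]
    · exact (key j (not_lt.1 hj)).1 (H j (not_lt.1 hj))
  · intro H j hj
    exact (key j hj).2 (congrFun H j)

lemma intVec_liftOf_mem_strip (h : d ≤ k)
    (hc : D.strip ∩ (refSubspace k d : Set (Fin k → ℝ)) = cubicalWindow k d)
    (m : Fin d → ℤ) : intVec (D.liftOf h m) + D.s ∈ D.strip := by
  rw [D.intVec_add_s_mem_strip_iff h hc, head_liftOf]

lemma isLift_iff (h : d ≤ k)
    (hc : D.strip ∩ (refSubspace k d : Set (Fin k → ℝ)) = cubicalWindow k d)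
    (n : Fin k → ℤ) (y : Fin k → ℝ) :
    D.IsLift n y ↔ ∃ m, n = D.liftOf h m ∧ D.pointOf h m = y := by
  rw [IsLift, D.intVec_add_s_mem_strip_iff h hc]
  constructor
  · rintro ⟨h1, h2⟩
    refine ⟨head h n, h1, ?_⟩
    rw [pointOf, ← h1, h2]
  · rintro ⟨m, rfl, h2⟩
    exact ⟨by rw [head_liftOf], h2⟩

lemma pointSet_eq_range (h : d ≤ k)
    (hc : D.strip ∩ (refSubspace k d : Set (Fin k → ℝ)) = cubicalWindow k d) :
    D.pointSet = Set.range (D.pointOf h) := by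
  ext y
  constructor
  · rintro ⟨_, ⟨hv, n, rfl⟩, rfl⟩
    obtain ⟨m, -, hm⟩ := (D.isLift_iff h hc n _).1 ⟨hv, rfl⟩
    exact ⟨m, hm⟩
  · rintro ⟨m, rfl⟩
    exact ⟨_, ⟨D.intVec_liftOf_mem_strip h hc m, _, rfl⟩, rfl⟩

lemma eq_of_proj_intVec_eq {n n' : Fin k → ℤ} (hn : D.proj (intVec n) = D.proj (intVec n')) :
    n = n' := D.injective hn

lemma pointOf_injective (h : d ≤ k) : Function.Injective (D.pointOf h) := by
  intro m m' hm
  simp only [pointOf, map_add, add_left_inj] at hm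
  rw [← D.head_liftOf h m, D.eq_of_proj_intVec_eq hm, head_liftOf]

lemma rho_mem_image_iff (h : d ≤ k) (v : Fin k → ℝ) (Ω : Set (Fin d → ℝ)) :
    D.rho v ∈ D.rho '' (embed k d '' Ω) ↔ head h v ∈ Ω := by
  constructor
  · rintro ⟨_, ⟨x, hx, rfl⟩, hv⟩
    have : head h v = x := by
      funext i
      have hi : ((Fin.castLE h i : Fin k) : ℕ) < d := i.2
      rw [head, ← D.rho_apply_of_lt v hi, ← hv, D.rho_apply_of_lt _ hi, embed_castLE]
    rwa [this]
  · exact fun hv => ⟨_, ⟨_, hv, rfl⟩, D.rho_embed_head h v⟩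

lemma patch_pointOf (h : d ≤ k)
    (hc : D.strip ∩ (refSubspace k d : Set (Fin k → ℝ)) = cubicalWindow k d)
    (m : Fin d → ℤ) (Ω : Set (Fin d → ℝ)) :
    D.patch (D.pointOf h m) Ω =
      (fun u => D.pointOf h (m + u)) '' {u : Fin d → ℤ | intVec u ∈ Ω} := by
  ext y
  constructor
  · rintro ⟨-, n, n', hn, hn', hΩ⟩
    obtain ⟨m₁, rfl, hm₁⟩ := (D.isLift_iff h hc _ _).1 hn
    obtain ⟨m₂, rfl, hm₂⟩ := (D.isLift_iff h hc _ _).1 hn'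
    obtain rfl := D.pointOf_injective h hm₁
    rw [← intVec_sub, D.rho_mem_image_iff h, head_intVec, head_liftOf_sub] at hΩ
    exact ⟨m₂ - m₁, hΩ, by simp [hm₂]⟩
  · rintro ⟨u, hu, rfl⟩
    refine ⟨by rw [D.pointSet_eq_range h hc]; exact ⟨_, rfl⟩, D.liftOf h m, D.liftOf h (m + u),
      (D.isLift_iff h hc _ _).2 ⟨m, rfl, rfl⟩, (D.isLift_iff h hc _ _).2 ⟨_, rfl, rfl⟩, ?_⟩
    rw [← intVec_sub, D.rho_mem_image_iff h, head_intVec, head_liftOf_sub, add_sub_cancel_left]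
    exact hu

/-- The points over `m` and `m'` see the same pattern in the integer rectangle with corners `a` and
`b`. -/
def SamePattern (h : d ≤ k) (a b m m' : Fin d → ℤ) : Prop :=
  ∀ u : Fin d → ℤ, (∀ i, a i ≤ u i ∧ u i ≤ b i) → ∀ j : Fin k, d ≤ (j : ℕ) →
    ⌊D.phase h j m - D.slope j (intVec u)⌋ = ⌊D.phase h j m' - D.slope j (intVec u)⌋

/-- Integer parts cancel, so the displacement of the lift depends on `m` only through its phase.
Hence patches are functions of the phases. -/
lemma liftOf_add_sub (h : d ≤ k) (m u : Fin d → ℤ) {j : Fin k} (hj : d ≤ (j : ℕ)) :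
    D.liftOf h (m + u) j - D.liftOf h m j = -⌊D.phase h j m - D.slope j (intVec u)⌋ := by
  rw [D.liftOf_of_le h _ hj, D.liftOf_of_le h _ hj, phase, Int.fract, intVec_add, map_add]
  have : D.offset h j - D.slope j (intVec m) - ⌊D.offset h j - D.slope j (intVec m)⌋
      - D.slope j (intVec u) = (D.offset h j - (D.slope j (intVec m) + D.slope j (intVec u)))
      - ⌊D.offset h j - D.slope j (intVec m)⌋ := by ring
  rw [this, Int.floor_sub_intCast]
  ring

lemma intVec_mem_Icc_iff {d : ℕ} (u a b : Fin d → ℤ) :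
    intVec u ∈ Set.Icc (intVec a) (intVec b) ↔ ∀ i, a i ≤ u i ∧ u i ≤ b i := by
  simp only [Set.mem_Icc, Pi.le_def, intVec, Int.cast_le, forall_and]

/-- Injectivity of the projection on `ℤ^k` turns equality of translated points into equality of
integer displacements. Their first `d` coordinates match up the indices `u`, and the others are the
floors being compared. -/
lemma patchEquiv_iff (h : d ≤ k)
    (hc : D.strip ∩ (refSubspace k d : Set (Fin k → ℝ)) = cubicalWindow k d)
    (a b m m' : Fin d → ℤ) :
    D.PatchEquiv (Set.Icc (intVec a) (intVec b)) (D.pointOf h m) (D.pointOf h m') ↔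
      D.SamePattern h a b m m' := by
  have key : ∀ u u' : Fin d → ℤ,
      D.pointOf h (m' + u') + (D.pointOf h m - D.pointOf h m') = D.pointOf h (m + u) ↔
        D.liftOf h (m' + u') - D.liftOf h m' = D.liftOf h (m + u) - D.liftOf h m := by
    intro u u'
    have e : D.pointOf h (m' + u') + (D.pointOf h m - D.pointOf h m') = D.pointOf h (m + u) ↔
        D.proj (intVec (D.liftOf h (m' + u') - D.liftOf h m')) =
          D.proj (intVec (D.liftOf h (m + u) - D.liftOf h m)) := by
      simp only [pointOf, intVec_sub, map_add, map_sub]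
      constructor <;> intro H
      · rw [sub_eq_sub_iff_add_eq_add]
        have := congrArg (fun z => z + D.proj (intVec (D.liftOf h m')) - D.proj D.s) H
        calc _ = D.proj (intVec (D.liftOf h (m' + u'))) + D.proj D.s +
          (D.proj (intVec (D.liftOf h m)) + D.proj D.s -
            (D.proj (intVec (D.liftOf h m')) + D.proj D.s)) +
            D.proj (intVec (D.liftOf h m')) - D.proj D.s := by abel
          _ = _ := by rw [this]; abel
      · rw [sub_eq_sub_iff_add_eq_add] at H
        calc _ = (D.proj (intVec (D.liftOf h (m' + u'))) + D.proj (intVec (D.liftOf h m))) +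
              D.proj D.s - D.proj (intVec (D.liftOf h m')) := by abel
          _ = _ := by rw [H]; abel
    rw [e]
    exact ⟨fun H => D.eq_of_proj_intVec_eq H, fun H => by rw [H]⟩
  have key' : ∀ u : Fin d → ℤ,
      D.liftOf h (m' + u) - D.liftOf h m' = D.liftOf h (m + u) - D.liftOf h m ↔
      ∀ j : Fin k, d ≤ (j : ℕ) → ⌊D.phase h j m - D.slope j (intVec u)⌋ =
        ⌊D.phase h j m' - D.slope j (intVec u)⌋ := by
    intro u
    constructor
    · intro H j hj
      have := congrFun H j
      simp only [Pi.sub_apply] at this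
      rw [D.liftOf_add_sub h _ _ hj, D.liftOf_add_sub h _ _ hj] at this
      omega
    · intro H
      funext j
      by_cases hj : (j : ℕ) < d
      · simp [liftOf, hj]
      · simp only [Pi.sub_apply]
        rw [D.liftOf_add_sub h _ _ (not_lt.1 hj), D.liftOf_add_sub h _ _ (not_lt.1 hj),
          H j (not_lt.1 hj)]
  have hu : ∀ u u' : Fin d → ℤ,
      D.liftOf h (m' + u') - D.liftOf h m' = D.liftOf h (m + u) - D.liftOf h m → u' = u := by
    intro u u' H
    funext i
    have := congrFun H (Fin.castLE h i)
    simpa [liftOf] using this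
  rw [PatchEquiv, D.patch_pointOf h hc, D.patch_pointOf h hc, Set.image_image]
  simp only [intVec_mem_Icc_iff]
  constructor
  · intro H u hab
    have : D.pointOf h (m + u) ∈ (fun u => D.pointOf h (m + u)) ''
      {u : Fin d → ℤ | ∀ i, a i ≤ u i ∧ u i ≤ b i} := ⟨u, hab, rfl⟩
    rw [H] at this
    obtain ⟨u', -, hu'⟩ := this
    have h2 := (key _ _).1 hu'
    obtain rfl := hu _ _ h2
    exact (key' _).1 h2
  · intro H
    refine Set.image_congr fun u hab => ?_
    exact ((key u u).2 ((key' u).2 (H u hab))).symm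

/-! ### Linear repetitivity as recurrence in `ℤ^d` -/

/-- Every pattern in an integer rectangle of volume `l ^ d` recurs at distance at most `A * l` from
every point. -/
def RecursWith (h : d ≤ k) (A : ℝ) : Prop :=
  ∀ a b : Fin d → ℤ, (∀ i, a i < b i) → (∀ i, a i ≤ 0 ∧ 0 ≤ b i) →
    ∀ l : ℝ, 1 ≤ l → l ^ d = ∏ i, ((b i : ℝ) - a i) → ∀ (m : Fin d → ℤ) (x : Fin d → ℝ),
      ∃ m' : Fin d → ℤ, (∀ i, |(m' i : ℝ) - x i| ≤ A * l) ∧ D.SamePattern h a b m m'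

/-- Balls test the position of the projected point, whereas recurrence is stated for its index `m`.
Up to the fixed shift by `s` the two differ boundedly, and since `l ≥ 1` the error is absorbed into
a multiple of `l`. -/
lemma exists_pointOf_bound (h : d ≤ k)
    (hc : D.strip ∩ (refSubspace k d : Set (Fin k → ℝ)) = cubicalWindow k d) :
    ∃ K : ℝ, 0 ≤ K ∧ ∀ (m : Fin d → ℤ) (i : Fin d),
      |D.pointOf h m (Fin.castLE h i) - (m i + head h D.s i)| ≤ K := by
  obtain ⟨K, hK, H⟩ := D.exists_proj_bound hc
  refine ⟨K, hK, fun m i => ?_⟩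
  have := H _ (D.intVec_liftOf_mem_strip h hc m) (Fin.castLE h i) i.2
  simpa [pointOf, intVec, liftOf, head] using this

lemma proj_mem (v : Fin k → ℝ) : D.proj v ∈ D.E := Submodule.projection_apply_mem D.isCompl v

lemma pointOf_mem_image_iff (h : d ≤ k) (m : Fin d → ℤ) (Ω : Set (Fin d → ℝ)) :
    D.pointOf h m ∈ D.rho '' (embed k d '' Ω) ↔ head h (D.pointOf h m) ∈ Ω := by
  rw [← D.rho_mem_image_iff h, pointOf, D.rho_of_mem (D.proj_mem _)]

lemma volume_Icc_intVec {a b : Fin d → ℤ} (hab : ∀ i, a i < b i) :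
    MeasureTheory.volume (Set.Icc (intVec a) (intVec b)) =
      ENNReal.ofReal (∏ i, ((b i : ℝ) - a i)) := by
  rw [Real.volume_Icc_pi, ENNReal.ofReal_prod_of_nonneg]
  · rfl
  · intro i _
    have : (a i : ℝ) < b i := by exact_mod_cast hab i
    linarith

lemma exists_recursWith (h : d ≤ k) (hd : 1 ≤ d)
    (hc : D.strip ∩ (refSubspace k d : Set (Fin k → ℝ)) = cubicalWindow k d)
    (hLR : D.IsLRWith (alignedRectangles d)) : ∃ A : ℝ, 0 < A ∧ D.RecursWith h A := by
  obtain ⟨C, hC, H⟩ := hLR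
  obtain ⟨K, hK, hb⟩ := D.exists_pointOf_bound h hc
  have hd0 : d ≠ 0 := by omega
  obtain ⟨t, ht, htd⟩ : ∃ t : ℝ, 0 < t ∧ t ^ d = C :=
    ⟨C ^ (1 / d : ℝ), Real.rpow_pos_of_pos hC _, by
      rw [one_div]; exact Real.rpow_inv_natCast_pow hC.le hd0⟩
  -- A sup-norm ball of volume `C * l ^ d` has radius `t * l / 2`, because `t ^ d = C`.
  refine ⟨t / 2 + K, by positivity, fun a b hab hab0 l hl hlV m x => ?_⟩
  have hr : 0 < t * l / 2 := by positivity
  obtain ⟨y', hy', hyB, hP⟩ := H _ ⟨a, b, hab, hab0, rfl⟩ (D.pointOf h m)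
    (by rw [D.pointSet_eq_range h hc]; exact ⟨m, rfl⟩) (x + head h D.s) (t * l / 2) (by
      rw [Real.volume_pi_ball _ hr, volume_Icc_intVec hab, ← ENNReal.ofReal_mul hC.le, ← hlV,
        ← htd, Fintype.card_fin, ← mul_pow]
      congr 2
      ring)
  rw [D.pointSet_eq_range h hc] at hy'
  obtain ⟨m', rfl⟩ := hy'
  refine ⟨m', fun i => ?_, (D.patchEquiv_iff h hc a b m m').1 hP⟩
  rw [D.pointOf_mem_image_iff h, Metric.mem_ball, dist_pi_lt_iff hr] at hyB
  have h1 := hyB i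
  have h2 := hb m' i
  rw [Real.dist_eq] at h1
  simp only [head, Pi.add_apply] at h1 h2
  have h3 : K ≤ K * l := le_mul_of_one_le_right hK hl
  rw [abs_le] at *
  rw [abs_lt] at h1
  constructor <;> linarith [h1.1, h1.2, h2.1, h2.2]

lemma isLRWith_of_recursWith (h : d ≤ k) (hd : 1 ≤ d)
    (hc : D.strip ∩ (refSubspace k d : Set (Fin k → ℝ)) = cubicalWindow k d) {A : ℝ}
    (hA : 0 < A) (hR : D.RecursWith h A) : D.IsLRWith (alignedRectangles d) := by
  obtain ⟨K, hK, hb⟩ := D.exists_pointOf_bound h hc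
  have hd0 : d ≠ 0 := by omega
  -- The radius becomes `(A + K + 1/2) * l`; the extra half gives the strict inequality needed for
  -- an open ball.
  refine ⟨(2 * (A + K) + 1) ^ d, by positivity, ?_⟩
  rintro _ ⟨a, b, hab, hab0, rfl⟩ y hy x r hvol
  rw [D.pointSet_eq_range h hc] at hy
  obtain ⟨m, rfl⟩ := hy
  have hV : 1 ≤ ∏ i, ((b i : ℝ) - a i) := by
    rw [← Finset.prod_const_one (s := (Finset.univ : Finset (Fin d)))]
    refine Finset.prod_le_prod (fun _ _ => zero_le_one) fun i _ => ?_
    have : (a i : ℝ) + 1 ≤ b i := by exact_mod_cast hab i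
    linarith
  obtain ⟨l, hl0, hlV⟩ : ∃ l : ℝ, 0 ≤ l ∧ l ^ d = ∏ i, ((b i : ℝ) - a i) :=
    ⟨(∏ i, ((b i : ℝ) - a i)) ^ (1 / d : ℝ), by positivity, by
      rw [one_div]; exact Real.rpow_inv_natCast_pow (by linarith) hd0⟩
  have hl : 1 ≤ l := by
    by_contra hlt
    have := pow_lt_one₀ hl0 (not_le.1 hlt) hd0
    linarith
  have hr : 0 < r := by
    by_contra hr
    rw [Metric.ball_eq_empty.2 (not_lt.1 hr), MeasureTheory.measure_empty, volume_Icc_intVec hab,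
      ← ENNReal.ofReal_mul (by positivity), eq_comm, ENNReal.ofReal_eq_zero] at hvol
    have : 0 < (2 * (A + K) + 1) ^ d * ∏ i, ((b i : ℝ) - a i) := by positivity
    linarith
  have hrl : 2 * r = (2 * (A + K) + 1) * l := by
    rw [Real.volume_pi_ball _ hr, volume_Icc_intVec hab, ← ENNReal.ofReal_mul (by positivity),
      ← hlV, Fintype.card_fin, ← mul_pow,
      ENNReal.ofReal_eq_ofReal_iff (by positivity) (by positivity)] at hvol
    exact (pow_left_inj₀ (by positivity) (by positivity) hd0).1 hvol
  obtain ⟨m', hm', hP⟩ := hR a b hab hab0 l hl hlV m (x - head h D.s)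
  refine ⟨D.pointOf h m', by rw [D.pointSet_eq_range h hc]; exact ⟨m', rfl⟩, ?_,
    (D.patchEquiv_iff h hc a b m m').2 hP⟩
  rw [D.pointOf_mem_image_iff h, Metric.mem_ball, dist_pi_lt_iff hr]
  intro i
  have h1 := hm' i
  have h2 := hb m' i
  rw [Real.dist_eq]
  simp only [head, Pi.sub_apply] at h1 h2 ⊢
  have h3 : K ≤ K * l := le_mul_of_one_le_right hK hl
  rw [abs_le] at *
  rw [abs_lt]
  constructor <;> linarith [h1.1, h1.2, h2.1, h2.2]

end Data

/-! ### Density of the internal coordinates -/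

namespace Data

variable {k d : ℕ} (D : Data k d)

/-- A point of `E` that is close modulo `ℤ^k` to `(0, offset - t)` has nearly integral first
coordinates; rounding them gives `m`. -/
lemma exists_slope_approx (h : d ≤ k) (hirr : D.IsTotallyIrrational) (t : Fin k → ℝ) {δ : ℝ}
    (hδ : 0 < δ) : ∃ (m : Fin d → ℤ) (z : Fin k → ℤ), ∀ j : Fin k, d ≤ (j : ℕ) →
      |D.offset h j - D.slope j (intVec m) - z j - t j| < δ := by
  set f := LinearMap.toContinuousLinearMap (D.rho ∘ₗ embedLin k d) with hf
  have hfs : ∀ (j : Fin k) (x : Fin d → ℝ), |D.slope j x| ≤ ‖f‖ * ‖x‖ := by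
    intro j x
    have h1 : D.slope j x = f x j := rfl
    rw [h1, ← Real.norm_eq_abs]
    exact (norm_le_pi_norm _ j).trans (f.le_opNorm x)
  -- Rounding the head changes the slope by at most `‖f‖` times this tolerance, and the coordinate
  -- `j` adds the tolerance once more.
  have hη : 0 < δ / (‖f‖ + 2) := by positivity
  set τ : Fin k → ℝ := fun i => if (i : ℕ) < d then 0 else D.offset h i - t i with hτ
  obtain ⟨_, hdist, ⟨e, he, rfl⟩⟩ := Metric.dense_iff.1 hirr (fun i => (τ i : UnitAddCircle)) _ hη
  have hclose : ∀ i, |e i - τ i - round (e i - τ i)| < δ / (‖f‖ + 2) := by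
    intro i
    have h1 := (dist_pi_lt_iff hη).1 (Metric.mem_ball.1 hdist) i
    rw [dist_eq_norm, ← AddCircle.coe_sub, UnitAddCircle.norm_eq] at h1
    exact h1
  have hE := (D.mem_E_iff h e).1 he
  set m : Fin d → ℤ := fun i => round (head h e i) with hm
  refine ⟨m, fun j => -round (e j - τ j), fun j hj => ?_⟩
  have hx : ‖head h e - intVec m‖ ≤ δ / (‖f‖ + 2) := by
    refine (pi_norm_le_iff_of_nonneg hη.le).2 fun i => ?_
    have := hclose (Fin.castLE h i)
    simp only [hτ, Fin.val_castLE, i.2, if_true, sub_zero] at this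
    exact this.le
  have h1 := hE j hj
  have h2 : D.slope j (intVec m) = e j - D.slope j (head h e - intVec m) := by
    rw [map_sub, h1]; ring
  have h3 := (hfs j (head h e - intVec m)).trans (mul_le_mul_of_nonneg_left hx (norm_nonneg f))
  have h4 := hclose j
  have h5 : τ j = D.offset h j - t j := by simp [hτ, not_lt.2 hj]
  have h6 : ‖f‖ * (δ / (‖f‖ + 2)) + 2 * (δ / (‖f‖ + 2)) = δ := by
    field_simp
  rw [h2]
  push_cast
  rw [h5] at h4 ⊢
  rw [abs_lt] at *
  rw [abs_le] at h3
  constructor <;> linarith [h3.1, h3.2, h4.1, h4.2]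

lemma phase_nonneg (h : d ≤ k) (j : Fin k) (m : Fin d → ℤ) : 0 ≤ D.phase h j m :=
  Int.fract_nonneg _

lemma phase_lt_one (h : d ≤ k) (j : Fin k) (m : Fin d → ℤ) : D.phase h j m < 1 :=
  Int.fract_lt_one _

/-- The internal coordinates of a totally irrational cut and project set are dense in the window. -/
lemma exists_phase_mem_Ioo (h : d ≤ k) (hirr : D.IsTotallyIrrational) (p q : Fin k → ℝ)
    (hpq : ∀ j : Fin k, 0 ≤ p j ∧ p j < q j ∧ q j ≤ 1) :
    ∃ m : Fin d → ℤ, ∀ j : Fin k, d ≤ (j : ℕ) → D.phase h j m ∈ Set.Ioo (p j) (q j) := by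
  have hopen : IsOpen (Set.univ.pi fun j => Set.Ioo (p j) (q j)) :=
    isOpen_set_pi Set.finite_univ fun j _ => isOpen_Ioo
  set t : Fin k → ℝ := fun j => (p j + q j) / 2 with ht
  have htm : t ∈ Set.univ.pi fun j => Set.Ioo (p j) (q j) := fun j _ =>
    ⟨by have := (hpq j).2.1; simp only [ht]; linarith,
      by have := (hpq j).2.1; simp only [ht]; linarith⟩
  obtain ⟨δ, hδ, hball⟩ := Metric.isOpen_iff.1 hopen t htm
  obtain ⟨m, z, hz⟩ := D.exists_slope_approx h hirr t hδ
  refine ⟨m, fun j hj => ?_⟩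
  have h1 : (fun i : Fin k => if d ≤ (i : ℕ) then D.offset h i - D.slope i (intVec m) - z i else t i) ∈
      Metric.ball t δ := by
    rw [Metric.mem_ball, dist_pi_lt_iff hδ]
    intro i
    rw [Real.dist_eq]
    split_ifs with hi
    · exact hz i hi
    · simpa using hδ
  have h2 := hball h1 j (Set.mem_univ j)
  simp only [hj, if_true] at h2
  have h3 : D.phase h j m = D.offset h j - D.slope j (intVec m) - z j := by
    rw [phase, Int.fract_eq_iff]
    exact ⟨(hpq j).1.trans h2.1.le, h2.2.trans_le (hpq j).2.2, z j, by ring⟩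
  rwa [h3]

end Data

/-! ### Counting -/

lemma exists_gap (T : Finset ℝ) (p : ℝ) : ∃ q, p < q ∧ ∀ t ∈ T, p < t → q ≤ t := by
  induction T using Finset.induction_on with
  | empty => exact ⟨p + 1, by linarith, by simp⟩
  | insert t T _ ih =>
    obtain ⟨q, hq, H⟩ := ih
    by_cases ht : p < t
    · refine ⟨min q t, lt_min hq ht, fun x hx hpx => ?_⟩
      rcases Finset.mem_insert.1 hx with rfl | hx
      · exact min_le_right _ _
      · exact (min_le_left _ _).trans (H x hx hpx)
    · refine ⟨q, hq, fun x hx hpx => ?_⟩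
      rcases Finset.mem_insert.1 hx with rfl | hx
      · exact absurd hpx ht
      · exact H x hx hpx

/-- As `w` crosses the fractional part of `t`, the floor jumps. These jumps are the walls between
patterns. -/
lemma floor_sub_ne {w w' t : ℝ} (h1 : w < Int.fract t) (h2 : Int.fract t ≤ w') :
    ⌊w - t⌋ ≠ ⌊w' - t⌋ := by
  have e : ∀ v : ℝ, ⌊v - t⌋ = ⌊v - Int.fract t⌋ - ⌊t⌋ := by
    intro v
    rw [← Int.floor_sub_intCast, Int.fract]
    congr 1
    ring
  rw [e, e]
  have h3 : ⌊w - Int.fract t⌋ < 0 := Int.floor_lt.2 (by push_cast; linarith)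
  have h4 : 0 ≤ ⌊w' - Int.fract t⌋ := Int.floor_nonneg.2 (by linarith)
  omega

lemma fract_nat_mul_injective {θ : ℝ} (hθ : Irrational θ) {a b : ℕ}
    (h : Int.fract (a * θ) = Int.fract (b * θ)) : a = b := by
  by_contra hab
  obtain ⟨z, hz⟩ := Int.fract_eq_fract.1 h
  have hne : ((a : ℤ) - b : ℤ) ≠ 0 := by omega
  have := hθ.intCast_mul hne
  push_cast at this
  rw [sub_mul, hz] at this
  exact this.ne_int z rfl

/-- The multiples `0, θ, …, Nθ` of an irrational number cut the circle into `N + 1` arcs. -/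
lemma exists_separated_intervals {θ : ℝ} (hθ : Irrational θ) (N : ℕ) :
    ∃ f g : ℕ → ℝ, (∀ a, 0 ≤ f a ∧ f a < g a ∧ g a ≤ 1) ∧
      ∀ a ≤ N, ∀ a' ≤ N, ∀ w ∈ Set.Ioo (f a) (g a), ∀ w' ∈ Set.Ioo (f a') (g a'),
        (∀ b : ℕ, b ≤ N → ⌊w - b * θ⌋ = ⌊w' - b * θ⌋) → a = a' := by
  -- The point `1` closes the last arc.
  set T : Finset ℝ := insert 1 ((Finset.range (N + 1)).image fun a : ℕ => Int.fract (a * θ))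
    with hT
  choose g hg hgT using fun a : ℕ => exists_gap T (Int.fract (a * θ))
  refine ⟨fun a => Int.fract (a * θ), g, fun a => ⟨Int.fract_nonneg _, hg a, ?_⟩, ?_⟩
  · exact hgT a 1 (Finset.mem_insert_self _ _) (Int.fract_lt_one _)
  · have key : ∀ a ≤ N, ∀ a' ≤ N, ∀ w ∈ Set.Ioo (Int.fract (a * θ)) (g a),
        ∀ w' ∈ Set.Ioo (Int.fract (a' * θ)) (g a'), Int.fract (a * θ) < Int.fract (a' * θ) →
        ⌊w - a' * θ⌋ ≠ ⌊w' - a' * θ⌋ := by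
      intro a _ a' ha' w hw w' hw' hlt
      refine floor_sub_ne (hw.2.trans_le (hgT a _ ?_ hlt)) hw'.1.le
      exact Finset.mem_insert_of_mem (Finset.mem_image.2 ⟨a', by simpa using ha', rfl⟩)
    intro a ha a' ha' w hw w' hw' H
    rcases lt_trichotomy (Int.fract (a * θ)) (Int.fract (a' * θ)) with hlt | heq | hgt
    · exact absurd (H a' ha') (key a ha a' ha' w hw w' hw' hlt)
    · exact fract_nat_mul_injective hθ heq
    · exact absurd (H a ha).symm (key a' ha' a ha w' hw' w hw hgt)

lemma card_Icc_floor_le {B : ℝ} (hB : 0 ≤ B) :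
    ((Finset.Icc (-⌊B⌋) ⌊B⌋).card : ℝ) ≤ 2 * B + 1 := by
  have h0 : 0 ≤ ⌊B⌋ := Int.floor_nonneg.2 hB
  rw [Int.card_Icc]
  have : ((⌊B⌋ + 1 - -⌊B⌋).toNat : ℝ) = ((2 * ⌊B⌋ + 1 : ℤ) : ℝ) := by
    rw [← Int.cast_natCast, Int.toNat_of_nonneg (by omega)]
    congr 1
    ring
  rw [this]
  push_cast
  linarith [Int.floor_le B]

lemma mem_Icc_floor {B : ℝ} {n : ℤ} (h : |(n : ℝ)| ≤ B) : n ∈ Finset.Icc (-⌊B⌋) ⌊B⌋ := by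
  rw [abs_le] at h
  rw [Finset.mem_Icc]
  have h1 : n ≤ ⌊B⌋ := Int.le_floor.2 h.2
  have h2 : -n ≤ ⌊B⌋ := Int.le_floor.2 (by push_cast; linarith [h.1])
  omega

lemma card_le_of_injective_of_abs_le {ι : Type*} [Fintype ι] {d : ℕ} {B : ℝ} (hB : 0 ≤ B)
    (f : ι → Fin d → ℤ) (hf : Function.Injective f) (hb : ∀ a i, |(f a i : ℝ)| ≤ B) :
    (Fintype.card ι : ℝ) ≤ (2 * B + 1) ^ d := by
  classical
  have h1 : Fintype.card ι ≤
      (Fintype.piFinset fun _ : Fin d => Finset.Icc (-⌊B⌋) ⌊B⌋).card := by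
    rw [← Finset.card_univ]
    refine Finset.card_le_card_of_injOn f (fun a _ => ?_) hf.injOn
    rw [Finset.mem_coe, Fintype.mem_piFinset]
    exact fun i => mem_Icc_floor (hb a i)
  rw [Fintype.card_piFinset_const] at h1
  calc (Fintype.card ι : ℝ) ≤ ((Finset.Icc (-⌊B⌋) ⌊B⌋).card : ℝ) ^ d := by exact_mod_cast h1
    _ ≤ _ := pow_le_pow_left₀ (Nat.cast_nonneg _) (card_Icc_floor_le hB) d

lemma card_le_of_injective_of_abs_le_of_mod {ι : Type*} [Fintype ι] {d : ℕ} {B : ℝ} (hB : 0 ≤ B)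
    (i₀ : Fin d) (q : ℕ) (f : ι → Fin d → ℤ) (hf : Function.Injective f)
    (hb : ∀ a, ∀ i ≠ i₀, |(f a i : ℝ)| ≤ B) (hq : ∀ a, 0 ≤ f a i₀ ∧ f a i₀ < q) :
    (Fintype.card ι : ℝ) ≤ q * (2 * B + 1) ^ (d - 1) := by
  classical
  have h1 : Fintype.card ι ≤ (Fintype.piFinset fun i : Fin d =>
      if i = i₀ then Finset.Ico (0 : ℤ) q else Finset.Icc (-⌊B⌋) ⌊B⌋).card := by
    rw [← Finset.card_univ]
    refine Finset.card_le_card_of_injOn f (fun a _ => ?_) hf.injOn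
    rw [Finset.mem_coe, Fintype.mem_piFinset]
    intro i
    split_ifs with hi
    · subst hi; simpa using hq a
    · exact mem_Icc_floor (hb a i hi)
  rw [Fintype.card_piFinset, ← Finset.mul_prod_erase _ _ (Finset.mem_univ i₀), if_pos rfl,
    Finset.prod_congr rfl (g := fun _ => (Finset.Icc (-⌊B⌋) ⌊B⌋).card)
      (fun i hi => by rw [if_neg (Finset.ne_of_mem_erase hi)]), Finset.prod_const,
    Finset.card_erase_of_mem (Finset.mem_univ _), Finset.card_univ, Fintype.card_fin] at h1
  have h2 : (Finset.Ico (0 : ℤ) q).card = q := by simp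
  rw [h2] at h1
  calc (Fintype.card ι : ℝ) ≤ q * ((Finset.Icc (-⌊B⌋) ⌊B⌋).card : ℝ) ^ (d - 1) := by
        exact_mod_cast h1
    _ ≤ _ := by
      gcongr
      exact card_Icc_floor_le hB

/-! ### Codimension greater than one -/

namespace Data

variable {k d : ℕ} (D : Data k d)

/-- The entries of the matrix of the linear map whose graph is `E`. -/
def coeff (j : Fin k) (i : Fin d) : ℝ := D.slope j (Pi.single i 1)

lemma slope_eq_sum (j : Fin k) (x : Fin d → ℝ) : D.slope j x = ∑ i, x i * D.coeff j i := by
  conv_lhs => rw [← Finset.univ_sum_single x]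
  rw [map_sum]
  refine Finset.sum_congr rfl fun i _ => ?_
  rw [coeff, ← smul_eq_mul, ← map_smul, ← Pi.single_smul, smul_eq_mul, mul_one]

lemma slope_intVec_single (j : Fin k) (i : Fin d) (z : ℤ) :
    D.slope j (intVec (Pi.single i z)) = z * D.coeff j i := by
  rw [slope_eq_sum, Finset.sum_eq_single i]
  · simp [intVec]
  · intro l _ hl
    simp [intVec, hl]
  · simp

lemma phase_add_eq_of_slope_eq_int (h : d ≤ k) (j : Fin k) (m u : Fin d → ℤ) {z : ℤ}
    (hz : D.slope j (intVec u) = z) : D.phase h j (m + u) = D.phase h j m := by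
  rw [phase, phase, intVec_add, map_add, hz, ← sub_sub, Int.fract_sub_intCast]

/-- The extremal shape: `[0, M ^ d]` in direction `i` and `[0, 1]` in the others has volume `M ^ d`,
so it resolves `M ^ d + 1` multiples of one coefficient while recurrence stays within `A * M`. -/
lemma RecursWith.exists_of_segment {D : Data k d} {h : d ≤ k} {A : ℝ} (hR : D.RecursWith h A)
    (i : Fin d) {M : ℕ} (hM : 1 ≤ M) (m : Fin d → ℤ) :
    ∃ m' : Fin d → ℤ, (∀ l, |(m' l : ℝ)| ≤ A * M) ∧ ∀ j : Fin k, d ≤ (j : ℕ) →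
      ∀ b : ℕ, b ≤ M ^ d → ⌊D.phase h j m - b * D.coeff j i⌋ =
        ⌊D.phase h j m' - b * D.coeff j i⌋ := by
  have hMd : (1 : ℤ) ≤ (M : ℤ) ^ d := by exact_mod_cast Nat.one_le_pow _ _ hM
  obtain ⟨m', hm', hP⟩ := hR 0 (fun l => if l = i then (M : ℤ) ^ d else 1)
    (fun l => by simp only [Pi.zero_apply]; split_ifs <;> omega)
    (fun l => by simp only [Pi.zero_apply]; split_ifs <;> omega) M (by exact_mod_cast hM)
    (by simp [apply_ite (Int.cast : ℤ → ℝ)]) m 0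
  refine ⟨m', fun l => by simpa using hm' l, fun j hj b hb => ?_⟩
  have := hP (Pi.single i (b : ℤ)) (fun l => ?_) j hj
  · rw [slope_intVec_single] at this
    exact_mod_cast this
  · by_cases hl : l = i
    · subst hl
      simp only [Pi.zero_apply, Pi.single_eq_same, if_true]
      exact ⟨by positivity, by exact_mod_cast hb⟩
    · simp [hl]

/-- By density all `(M ^ d + 1) ^ 2` pairs of arcs are realised. They need distinct recurrence
points in a cube with at most `(2A + 1) ^ d * M ^ d` of them, which fails once `M ≥ (2A + 1) ^ d`.
-/
lemma not_recursWith_of_irrational_of_irrational (h : d ≤ k) (hd : 1 ≤ d)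
    (hirr : D.IsTotallyIrrational) {j j' : Fin k} (hj : d ≤ (j : ℕ)) (hj' : d ≤ (j' : ℕ))
    (hjj : j' ≠ j) {i : Fin d} (h1 : Irrational (D.coeff j i)) (h2 : Irrational (D.coeff j' i))
    {A : ℝ} (hA : 0 < A) : ¬ D.RecursWith h A := by
  intro hR
  obtain ⟨M, hM⟩ := exists_nat_ge ((2 * A + 1) ^ d)
  have hM1 : 1 ≤ M := by
    have : (1 : ℝ) ≤ (2 * A + 1) ^ d := one_le_pow₀ (by linarith)
    exact_mod_cast this.trans hM
  obtain ⟨f, g, hfg, hsep⟩ := exists_separated_intervals h1 (M ^ d)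
  obtain ⟨f', g', hfg', hsep'⟩ := exists_separated_intervals h2 (M ^ d)
  have hex : ∀ a : Fin (M ^ d + 1) × Fin (M ^ d + 1), ∃ m m' : Fin d → ℤ,
      D.phase h j m ∈ Set.Ioo (f a.1) (g a.1) ∧ D.phase h j' m ∈ Set.Ioo (f' a.2) (g' a.2) ∧
      (∀ l, |(m' l : ℝ)| ≤ A * M) ∧ ∀ j : Fin k, d ≤ (j : ℕ) →
      ∀ b : ℕ, b ≤ M ^ d → ⌊D.phase h j m - b * D.coeff j i⌋ =
        ⌊D.phase h j m' - b * D.coeff j i⌋ := by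
    intro a
    obtain ⟨m, hm⟩ := D.exists_phase_mem_Ioo h hirr
      (fun l => if l = j then f a.1 else f' a.2) (fun l => if l = j then g a.1 else g' a.2)
      (fun l => by
        split_ifs
        · exact hfg a.1
        · exact hfg' a.2)
    obtain ⟨m', hm', H⟩ := hR.exists_of_segment i hM1 m
    exact ⟨m, m', by simpa using hm j hj, by simpa [hjj] using hm j' hj', hm', H⟩
  choose m m' hm hm2 hm' H using hex
  have hinj : Function.Injective m' := by
    intro a a' haa
    have e1 := hsep a.1 (Nat.lt_succ_iff.1 a.1.2) a'.1 (Nat.lt_succ_iff.1 a'.1.2) _ (hm a) _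
      (hm a') fun b hb => by rw [H a j hj b hb, H a' j hj b hb, haa]
    have e2 := hsep' a.2 (Nat.lt_succ_iff.1 a.2.2) a'.2 (Nat.lt_succ_iff.1 a'.2.2) _ (hm2 a) _
      (hm2 a') fun b hb => by rw [H a j' hj' b hb, H a' j' hj' b hb, haa]
    exact Prod.ext (Fin.ext e1) (Fin.ext e2)
  have hcard := card_le_of_injective_of_abs_le (by positivity) m' hinj hm'
  rw [Fintype.card_prod, Fintype.card_fin] at hcard
  have hM1' : (1 : ℝ) ≤ M := by exact_mod_cast hM1
  have hb : (2 * (A * M) + 1) ^ d ≤ (2 * A + 1) ^ d * (M : ℝ) ^ d := by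
    rw [← mul_pow]
    exact pow_le_pow_left₀ (by positivity) (by linarith) d
  have hMM : (M : ℝ) ≤ (M : ℝ) ^ d := le_self_pow₀ hM1' (by omega)
  push_cast at hcard
  have hMd : (0 : ℝ) < (M : ℝ) ^ d := by positivity
  nlinarith [mul_le_mul_of_nonneg_right (hM.trans hMM) hMd.le]

/-- Moving by the denominator `q` of the rational coefficient preserves the phase, so one coordinate
counts only modulo `q`. The cube then offers at most `q * (2AM + 1) ^ (d - 1)` phases for `M ^ d +
1` arcs. -/
lemma not_recursWith_of_irrational_of_rational (h : d ≤ k)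
    (hirr : D.IsTotallyIrrational) {j : Fin k} (hj : d ≤ (j : ℕ)) {i i' : Fin d}
    (h1 : Irrational (D.coeff j i)) {r : ℚ} (hr : (r : ℝ) = D.coeff j i')
    {A : ℝ} (hA : 0 < A) : ¬ D.RecursWith h A := by
  intro hR
  set q := r.den with hq
  have hq0 : (0 : ℤ) < q := by exact_mod_cast r.den_pos
  obtain ⟨M, hM⟩ := exists_nat_ge (q * (2 * A + 1) ^ (d - 1))
  have hM1 : 1 ≤ M := by
    have h1 : (1 : ℝ) ≤ (2 * A + 1) ^ (d - 1) := one_le_pow₀ (by linarith)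
    have h2 : (1 : ℝ) ≤ q := by exact_mod_cast r.den_pos
    exact_mod_cast (one_le_mul_of_one_le_of_one_le h2 h1).trans hM
  obtain ⟨f, g, hfg, hsep⟩ := exists_separated_intervals h1 (M ^ d)
  have hex : ∀ a : Fin (M ^ d + 1), ∃ m m' : Fin d → ℤ,
      D.phase h j m ∈ Set.Ioo (f a) (g a) ∧
      (∀ l, |(m' l : ℝ)| ≤ A * M) ∧ ∀ b : ℕ, b ≤ M ^ d → ⌊D.phase h j m - b * D.coeff j i⌋ =
        ⌊D.phase h j m' - b * D.coeff j i⌋ := by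
    intro a
    obtain ⟨m, hm⟩ := D.exists_phase_mem_Ioo h hirr
      (fun _ => f a) (fun _ => g a) (fun _ => hfg a)
    obtain ⟨m', hm', H⟩ := hR.exists_of_segment i hM1 m
    exact ⟨m, m', hm j hj, hm', H j hj⟩
  choose m m' hm hm' H using hex
  -- Same phase as `m' a`, with coordinate `i'` reduced modulo `q`.
  set F : Fin (M ^ d + 1) → Fin d → ℤ := fun a => Function.update (m' a) i' (m' a i' % q) with hF
  have hphase : ∀ a, D.phase h j (F a) = D.phase h j (m' a) := by
    intro a
    have e : m' a = F a + Pi.single i' (q * (m' a i' / q)) := by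
      funext l
      by_cases hl : l = i'
      · subst hl
        simp only [hF, Pi.add_apply, Function.update_self, Pi.single_eq_same]
        exact (Int.emod_add_mul_ediv _ _).symm
      · simp [hF, hl]
    conv_rhs => rw [e]
    refine (D.phase_add_eq_of_slope_eq_int h j _ _ (z := r.num * (m' a i' / q)) ?_).symm
    rw [slope_intVec_single, ← hr]
    have : (r : ℝ) * q = r.num := by exact_mod_cast Rat.mul_den_eq_num r
    push_cast
    rw [← this]
    ring
  have hinj : Function.Injective F := by
    intro a a' haa
    have e1 := hsep a (Nat.lt_succ_iff.1 a.2) a' (Nat.lt_succ_iff.1 a'.2) _ (hm a) _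
      (hm a') fun b hb => by rw [H a b hb, H a' b hb, ← hphase a, ← hphase a', haa]
    exact Fin.ext e1
  have hcard := card_le_of_injective_of_abs_le_of_mod (B := A * M) (by positivity) i' q F hinj
    (fun a l hl => by simpa [hF, hl] using hm' a l)
    (fun a => by
      simp only [hF, Function.update_self]
      exact ⟨Int.emod_nonneg _ hq0.ne', Int.emod_lt_of_pos _ hq0⟩)
  rw [Fintype.card_fin] at hcard
  have hM1' : (1 : ℝ) ≤ M := by exact_mod_cast hM1
  have hb : (2 * (A * M) + 1) ^ (d - 1) ≤ (2 * A + 1) ^ (d - 1) * (M : ℝ) ^ (d - 1) := by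
    rw [← mul_pow]
    exact pow_le_pow_left₀ (by positivity) (by linarith) _
  have hMM : (M : ℝ) ^ d = M * (M : ℝ) ^ (d - 1) := by
    rw [← pow_succ', Nat.sub_add_cancel (by have := i.2; omega)]
  push_cast at hcard
  rw [hMM] at hcard
  have hMd : (0 : ℝ) < (M : ℝ) ^ (d - 1) := by positivity
  have h3 := mul_le_mul_of_nonneg_left hb (Nat.cast_nonneg (α := ℝ) q)
  have h4 := mul_le_mul_of_nonneg_right hM hMd.le
  linarith

/-- If the row were rational with common denominator `q`, the phases would lie in one coset of
`(1/q)ℤ` and could not be dense. -/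
lemma exists_irrational_coeff (h : d ≤ k) (hirr : D.IsTotallyIrrational) {j : Fin k}
    (hj : d ≤ (j : ℕ)) : ∃ i, Irrational (D.coeff j i) := by
  by_contra hcon
  have hrat : ∀ i, ∃ r : ℚ, (r : ℝ) = D.coeff j i := by
    intro i
    by_contra hi
    exact hcon ⟨i, fun ⟨r, hr⟩ => hi ⟨r, hr⟩⟩
  choose r hr using hrat
  set q : ℕ := ∏ i, (r i).den with hq
  have hq0 : (0 : ℝ) < q := by
    rw [hq]
    exact_mod_cast Finset.prod_pos fun i _ => (r i).den_pos
  have hslope : ∀ m : Fin d → ℤ, ∃ z : ℤ, q * D.slope j (intVec m) = z := by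
    intro m
    have : ∀ i, ∃ z : ℤ, q * (intVec m i * D.coeff j i) = z := by
      intro i
      obtain ⟨c, hc⟩ : (r i).den ∣ q := Finset.dvd_prod_of_mem _ (Finset.mem_univ i)
      refine ⟨c * m i * (r i).num, ?_⟩
      have e : (r i : ℝ) * (r i).den = (r i).num := by exact_mod_cast Rat.mul_den_eq_num (r i)
      rw [hc, ← hr]
      push_cast
      rw [← e, intVec]
      ring
    choose z hz using this
    refine ⟨∑ i, z i, ?_⟩
    rw [slope_eq_sum, Finset.mul_sum]
    push_cast
    exact Finset.sum_congr rfl fun i _ => hz i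
  have hphase : ∀ m, ∃ z : ℤ, q * (D.offset h j - D.phase h j m) = z := by
    intro m
    obtain ⟨z, hz⟩ := hslope m
    refine ⟨z + q * ⌊D.offset h j - D.slope j (intVec m)⌋, ?_⟩
    push_cast
    rw [phase, Int.fract, ← hz]
    ring
  have hw := D.phase_nonneg h j 0
  have hw1 := D.phase_lt_one h j 0
  set w := D.phase h j 0 with hwdef
  -- No element of the coset of `w` lies strictly between `w` and `w + 1 / q`.
  obtain ⟨m, hm⟩ := D.exists_phase_mem_Ioo h hirr (fun _ => w) (fun _ => min 1 (w + 1 / q))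
    (fun _ => ⟨hw, lt_min hw1 (by have := one_div_pos.2 hq0; linarith), min_le_left _ _⟩)
  have h1 := (hm j hj).1
  have h2 := (hm j hj).2.trans_le (min_le_right _ _)
  obtain ⟨z, hz⟩ := hphase m
  obtain ⟨z', hz'⟩ := hphase 0
  rw [← hwdef] at hz'
  have e : ((z' - z : ℤ) : ℝ) = q * (D.phase h j m - w) := by
    push_cast
    rw [← hz, ← hz']
    ring
  have h3 : (0 : ℝ) < ((z' - z : ℤ) : ℝ) := by
    rw [e]
    exact mul_pos hq0 (by linarith)
  have h4 : ((z' - z : ℤ) : ℝ) < 1 := by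
    rw [e]
    have : q * (1 / q : ℝ) = 1 := by field_simp
    nlinarith
  have h5 : 0 < z' - z := by exact_mod_cast h3
  have h6 : z' - z < 1 := by exact_mod_cast h4
  omega

/-- Take a column in which row `j'` is irrational. If row `j` is irrational there too, two rows
share an irrational column; otherwise row `j` mixes rational and irrational entries. -/
lemma not_isLRWith_of_one_lt (hd : 1 ≤ d) (hkd : 1 < k - d) (hD : D.IsCubical) :
    ¬ D.IsLRWith (alignedRectangles d) := by
  intro hLR
  have h : d ≤ k := by omega
  obtain ⟨-, hirr, -, hc⟩ := hD
  obtain ⟨A, hA, hR⟩ := D.exists_recursWith h hd hc hLR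
  set j : Fin k := ⟨d, by omega⟩ with hj
  set j' : Fin k := ⟨d + 1, by omega⟩ with hj'
  obtain ⟨i, hi⟩ := D.exists_irrational_coeff h hirr (j := j) le_rfl
  obtain ⟨i', hi'⟩ := D.exists_irrational_coeff h hirr (j := j') (Nat.le_succ d)
  by_cases hji : Irrational (D.coeff j i')
  · exact D.not_recursWith_of_irrational_of_irrational h hd hirr (j := j) (j' := j') le_rfl
      (Nat.le_succ d) (by simp [hj, hj', Fin.ext_iff]) hji hi' hA hR
  · rw [Irrational, not_not] at hji
    obtain ⟨r, hr⟩ := hji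
    exact D.not_recursWith_of_irrational_of_rational h hirr (j := j) le_rfl hi hr hA hR

end Data

/-! ### From linear repetitivity to badly approximable linear forms -/

/-- The linear form with coefficients `α` is multiplicatively badly approximable. -/
def IsBadLinearForm {d : ℕ} (α : Fin d → ℝ) (c : ℝ) : Prop :=
  ∀ u : Fin d → ℤ, u ≠ 0 → c ≤ (∏ i, max 1 |(u i : ℝ)|) * distInt (∑ i, u i * α i)

lemma distInt_nonneg (x : ℝ) : 0 ≤ distInt x := abs_nonneg _

lemma distInt_le_half (x : ℝ) : distInt x ≤ 1 / 2 := abs_sub_round x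

lemma distInt_le_abs_sub (x : ℝ) (z : ℤ) : distInt x ≤ |x - z| := round_le x z

lemma exists_one_le_pow_eq {d : ℕ} (hd : d ≠ 0) {V : ℝ} (hV : 1 ≤ V) :
    ∃ l : ℝ, 1 ≤ l ∧ l ^ d = V := by
  refine ⟨V ^ (d⁻¹ : ℝ), Real.one_le_rpow hV (by positivity), ?_⟩
  exact Real.rpow_inv_natCast_pow (by linarith) hd

lemma one_le_prod_of_one_le {ι : Type*} [Fintype ι] {f : ι → ℝ} (hf : ∀ i, 1 ≤ f i) :
    1 ≤ ∏ i, f i := by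
  rw [← Finset.prod_const_one (s := (Finset.univ : Finset ι))]
  exact Finset.prod_le_prod (fun _ _ => zero_le_one) fun i _ => hf i

namespace Data

variable {k d : ℕ} (D : Data k d)

/-- An integer vector on which the linear map defining `E` is integral is a period. -/
lemma eq_zero_of_slope_eq_int (h : d ≤ k) (hap : D.IsAperiodic)
    (hc : D.strip ∩ (refSubspace k d : Set (Fin k → ℝ)) = cubicalWindow k d)
    {u : Fin d → ℤ} {z : Fin k → ℤ}
    (hz : ∀ j : Fin k, d ≤ (j : ℕ) → D.slope j (intVec u) = z j) : u = 0 := by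
  set v : Fin k → ℤ := fun i => if hi : (i : ℕ) < d then u ⟨i, hi⟩ else z i with hv
  have hhead : head h v = u := by
    funext i
    simp [head, hv]
  have hvE : intVec v ∈ D.E := by
    rw [D.mem_E_iff h]
    intro j hj
    rw [head_intVec, hhead, hz j hj]
    simp [intVec, hv, not_lt.2 hj]
  have hlift : ∀ m, D.liftOf h (m + u) = D.liftOf h m + v := by
    intro m
    funext j
    by_cases hj : (j : ℕ) < d
    · simp [liftOf, hv, hj]
    · have hj' := not_lt.1 hj
      rw [Pi.add_apply, D.liftOf_of_le h _ hj', D.liftOf_of_le h _ hj', intVec_add, map_add,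
        hz j hj', ← sub_sub, Int.floor_sub_intCast]
      simp only [hv, hj, dite_false]
      ring
  have hpt : ∀ m, D.pointOf h (m + u) = D.pointOf h m + intVec v := by
    intro m
    have : D.proj (intVec v) = intVec v :=
      Submodule.projection_apply_of_mem_left D.isCompl hvE
    rw [pointOf, pointOf, hlift, intVec_add, add_right_comm, map_add, this]
  have h0 := hap _ hvE (by
    rw [D.pointSet_eq_range h hc]
    ext y
    constructor
    · rintro ⟨_, ⟨m, rfl⟩, rfl⟩
      exact ⟨m + u, hpt m⟩
    · rintro ⟨m, rfl⟩
      refine ⟨_, ⟨m - u, rfl⟩, ?_⟩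
      simp only
      rw [← hpt, sub_add_cancel])
  have hv0 : v = 0 := intVec_injective (by rw [h0, intVec_zero])
  rw [← hhead, hv0]
  rfl

/-- A pattern seen only over an arc of length `δ` has to recur with frequency at most `2δ`. -/
lemma RecursWith.one_le_mul_of_arc {D : Data k d} {h : d ≤ k} (hirr : D.IsTotallyIrrational)
    {j : Fin k} (hj : d ≤ (j : ℕ)) {A : ℝ} (hA : 0 < A) (hR : D.RecursWith h A)
    {a b : Fin d → ℤ} (hab : ∀ i, a i < b i) (hab0 : ∀ i, a i ≤ 0 ∧ 0 ≤ b i)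
    {l : ℝ} (hl : 1 ≤ l) (hlV : l ^ d = ∏ i, ((b i : ℝ) - a i)) {m : Fin d → ℤ} {p δ : ℝ}
    (hδ : 0 < δ)
    (hm : ∀ m', D.SamePattern h a b m m' → p ≤ D.phase h j m' ∧ D.phase h j m' < p + δ) :
    1 ≤ 2 * ((2 * A + 1) ^ d + 1) * (l ^ d * δ) := by
  -- The number of intervals of length `δ`, separated by gaps `δ`, that fit into the circle.
  set J := ⌊1 / (2 * δ)⌋₊ with hJ
  have hJδ : 2 * (J * δ) ≤ 1 := by
    have h1 : (J : ℝ) ≤ 1 / (2 * δ) := Nat.floor_le (by positivity)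
    rw [le_div_iff₀ (by positivity)] at h1
    linarith
  have hiδ : ∀ i : Fin J, ((i : ℕ) : ℝ) * δ + δ ≤ J * δ := by
    intro i
    have : ((i : ℕ) : ℝ) + 1 ≤ J := by exact_mod_cast i.2
    nlinarith
  -- The search for a recurrence is centred at `-t`, so that every `m' + t` lies in one cube about
  -- `0`. Modulo `1` and a constant, the sum of the phases of `m'` and `t` depends only on `m' + t`.
  -- The sums for different `i` are incongruent, so the `J` points `m' + t` are distinct and `J ≤
  -- (2Al + 1) ^ d`.
  have hex : ∀ i : Fin J, ∃ t m' : Fin d → ℤ,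
      D.phase h j t ∈ Set.Ioo (2 * (i * δ)) (2 * (i * δ) + δ) ∧
      (∀ r, |((m' + t) r : ℝ)| ≤ A * l) ∧ p ≤ D.phase h j m' ∧ D.phase h j m' < p + δ := by
    intro i
    obtain ⟨t, ht⟩ := D.exists_phase_mem_Ioo h hirr (fun _ => 2 * (i * δ))
      (fun _ => 2 * (i * δ) + δ) (fun _ => ⟨by positivity, by linarith, by linarith [hiδ i]⟩)
    obtain ⟨m', hm', hP⟩ := hR a b hab hab0 l hl hlV m (-intVec t)
    refine ⟨t, m', ht j hj, fun r => ?_, hm m' hP⟩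
    simpa [intVec] using hm' r
  choose t m' ht hb hp hp' using hex
  have hne : ∀ i i' : Fin J, i' < i → m' i + t i ≠ m' i' + t i' := by
    intro i i' hlt heq
    have e : D.slope j (intVec (m' i)) + D.slope j (intVec (t i)) =
        D.slope j (intVec (m' i')) + D.slope j (intVec (t i')) := by
      rw [← map_add, ← map_add, ← intVec_add, ← intVec_add, heq]
    have hz : ∃ z : ℤ, D.phase h j (m' i) + D.phase h j (t i) - D.phase h j (m' i') -
        D.phase h j (t i') = z := by
      refine ⟨⌊D.offset h j - D.slope j (intVec (m' i'))⌋ +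
        ⌊D.offset h j - D.slope j (intVec (t i'))⌋ -
        ⌊D.offset h j - D.slope j (intVec (m' i))⌋ -
        ⌊D.offset h j - D.slope j (intVec (t i))⌋, ?_⟩
      simp only [phase, Int.fract]
      push_cast
      linarith
    obtain ⟨z, hz⟩ := hz
    have h1 : ((i' : ℕ) : ℝ) * δ + δ ≤ (i : ℕ) * δ := by
      have : ((i' : ℕ) : ℝ) + 1 ≤ (i : ℕ) := by exact_mod_cast hlt
      nlinarith
    have h2 : (0 : ℝ) ≤ (i' : ℕ) * δ := by positivity
    have h3 := hiδ i
    have h4 := ht i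
    have h5 := ht i'
    have h6 : (0 : ℝ) < z := by
      rw [← hz]
      linarith [h4.1, h5.2, hp i, hp' i']
    have h7 : (z : ℝ) < 1 := by
      rw [← hz]
      linarith [h4.2, h5.1, hp' i, hp i']
    have h8 : 0 < z := by exact_mod_cast h6
    have h9 : z < 1 := by exact_mod_cast h7
    omega
  have hinj : Function.Injective fun i => m' i + t i := by
    intro i i' heq
    rcases lt_trichotomy i i' with hlt | heq' | hlt
    · exact absurd heq.symm (hne _ _ hlt)
    · exact heq'
    · exact absurd heq (hne _ _ hlt)
  have hcard := card_le_of_injective_of_abs_le (by positivity) _ hinj hb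
  rw [Fintype.card_fin] at hcard
  have hb : (2 * (A * l) + 1) ^ d ≤ (2 * A + 1) ^ d * l ^ d := by
    rw [← mul_pow]
    exact pow_le_pow_left₀ (by positivity) (by linarith) d
  have hlt : 1 / (2 * δ) < J + 1 := Nat.lt_floor_add_one _
  rw [div_lt_iff₀ (by positivity)] at hlt
  have hld : 1 ≤ l ^ d := one_le_pow₀ hl
  have h1 : (J : ℝ) + 1 ≤ ((2 * A + 1) ^ d + 1) * l ^ d := by linarith
  have h2 := mul_le_mul_of_nonneg_right h1 (by positivity : 0 ≤ 2 * δ)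
  linarith

/-- The rectangle spanned by `0` and `u` has volume `∏ max 1 |u i|` and sees the wall at the
fractional part of `L(u)`. That wall lies at distance `distInt x` from an end of the window, so a
pattern confined to this short arc exists and must recur. -/
lemma RecursWith.isBadLinearForm {D : Data k d} {h : d ≤ k} (hd : 1 ≤ d)
    (hirr : D.IsTotallyIrrational) (hap : D.IsAperiodic)
    (hc : D.strip ∩ (refSubspace k d : Set (Fin k → ℝ)) = cubicalWindow k d)
    {j : Fin k} (hj : d ≤ (j : ℕ)) (huniq : ∀ j' : Fin k, d ≤ (j' : ℕ) → j' = j)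
    {A : ℝ} (hA : 0 < A) (hR : D.RecursWith h A) :
    IsBadLinearForm (D.coeff j) (1 / (2 * ((2 * A + 1) ^ d + 1))) := by
  intro u hu
  have hslope : ∑ i, (u i : ℝ) * D.coeff j i = D.slope j (intVec u) := by
    rw [slope_eq_sum]; rfl
  rw [hslope]
  set x := D.slope j (intVec u) with hx
  have hδ : 0 < distInt x := by
    refine lt_of_le_of_ne (distInt_nonneg x) fun h0 => hu ?_
    refine D.eq_zero_of_slope_eq_int h hap hc (z := fun _ => round x) fun j' hj' => ?_
    rw [huniq j' hj', ← hx]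
    exact sub_eq_zero.1 (abs_eq_zero.1 h0.symm)
  -- Sides with `u i = 0` are widened to length `1`; this is the `max 1` in the definition of a bad
  -- linear form.
  set a : Fin d → ℤ := fun i => min 0 (u i) with ha
  set b : Fin d → ℤ := fun i => if u i = 0 then 1 else max 0 (u i) with hb
  have hab : ∀ i, a i < b i := by
    intro i
    simp only [ha, hb]
    split_ifs <;> omega
  have hab0 : ∀ i, a i ≤ 0 ∧ 0 ≤ b i := by
    intro i
    simp only [ha, hb]
    split_ifs <;> omega
  have hV : ∀ i, ((b i : ℝ) - a i) = max 1 |(u i : ℝ)| := by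
    intro i
    have : b i - a i = max 1 |u i| := by
      simp only [ha, hb]
      rcases abs_cases (u i) with ⟨h1, h2⟩ | ⟨h1, h2⟩ <;> rw [h1] <;> split_ifs <;> omega
    rw [← Int.cast_sub, this]
    push_cast
    rfl
  have hone : (1 : ℝ) ≤ ∏ i, ((b i : ℝ) - a i) :=
    one_le_prod_of_one_le fun i => by rw [hV]; exact le_max_left _ _
  obtain ⟨l, hl, hlV⟩ := exists_one_le_pow_eq (by omega : d ≠ 0) hone
  have humem : ∀ i, a i ≤ u i ∧ u i ≤ b i := by
    intro i
    simp only [ha, hb]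
    split_ifs <;> omega
  have key : ∃ (m : Fin d → ℤ) (p : ℝ), ∀ m', D.SamePattern h a b m m' →
      p ≤ D.phase h j m' ∧ D.phase h j m' < p + distInt x := by
    have hhalf := distInt_le_half x
    -- The short arc is at the left end of `[0, 1)` if `x` lies above its nearest integer, and at
    -- the right end otherwise.
    rcases le_total 0 (x - round x) with hs | hs
    · have hfr : Int.fract x = distInt x := by
        rw [Int.fract_eq_iff]
        refine ⟨hδ.le, by linarith, round x, ?_⟩
        rw [distInt, abs_of_nonneg hs]
        ring
      obtain ⟨m, hm⟩ := D.exists_phase_mem_Ioo h hirr (fun _ => 0) (fun _ => distInt x)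
        (fun _ => ⟨le_rfl, hδ, by linarith⟩)
      refine ⟨m, 0, fun m' hP => ⟨D.phase_nonneg h j m', ?_⟩⟩
      by_contra hcon
      refine floor_sub_ne (t := x) ?_ ?_ (hP u humem j hj)
      · rw [hfr]; exact (hm j hj).2
      · rw [hfr]; linarith
    · have hfr : Int.fract x = 1 - distInt x := by
        rw [Int.fract_eq_iff]
        refine ⟨by linarith, by linarith, round x - 1, ?_⟩
        rw [distInt, abs_of_nonpos hs]
        push_cast
        ring
      obtain ⟨m, hm⟩ := D.exists_phase_mem_Ioo h hirr (fun _ => 1 - distInt x) (fun _ => 1)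
        (fun _ => ⟨by linarith, by linarith, le_rfl⟩)
      refine ⟨m, 1 - distInt x, fun m' hP => ⟨?_, by linarith [D.phase_lt_one h j m']⟩⟩
      by_contra hcon
      refine floor_sub_ne (t := x) ?_ ?_ (hP u humem j hj).symm
      · rw [hfr]; exact not_le.1 hcon
      · rw [hfr]; exact (hm j hj).1.le
  obtain ⟨m, p, hm⟩ := key
  have hfinal := hR.one_le_mul_of_arc hirr hj hA hab hab0 hl hlV hδ hm
  rw [hlV, Finset.prod_congr rfl fun i _ => hV i] at hfinal
  rw [div_le_iff₀ (by positivity)]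
  linarith

end Data

/-! ### Transference between linear forms and simultaneous approximation -/

/-- The tuple `α` is multiplicatively badly approximable. -/
def IsBadTuple {d : ℕ} (α : Fin d → ℝ) (c : ℝ) : Prop :=
  ∀ n : ℕ, 1 ≤ n → c ≤ n * ∏ i, distInt (n * α i)

lemma IsBadLinearForm.distInt_mul_pos {d : ℕ} {α : Fin d → ℝ} {c : ℝ} (hc : 0 < c)
    (h : IsBadLinearForm α c) {n : ℕ} (hn : 1 ≤ n) (i : Fin d) : 0 < distInt (n * α i) := by
  have h1 := h (Pi.single i (n : ℤ)) (by
    rw [Ne, Pi.single_eq_zero_iff]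
    omega)
  have h2 : ∑ l, ((Pi.single i (n : ℤ) : Fin d → ℤ) l : ℝ) * α l = n * α i := by
    rw [Finset.sum_eq_single i]
    · simp
    · intro l _ hl
      simp [hl]
    · simp
  rw [h2] at h1
  refine lt_of_le_of_ne (distInt_nonneg _) fun h0 => ?_
  rw [← h0, mul_zero] at h1
  linarith

/-- The values of a linear form with rational approximations `p i / n` to its coefficients. -/
lemma distInt_sum_le {d : ℕ} {α : Fin d → ℝ} {n : ℕ} (hn : 1 ≤ n) {w : Fin d → ℤ} {σ : ℝ}
    (hw : ∀ i, |(w i : ℝ)| * distInt (n * α i) ≤ σ)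
    (hdvd : (n : ℤ) ∣ ∑ i, w i * round (n * α i)) :
    distInt (∑ i, w i * α i) ≤ d * σ / n := by
  obtain ⟨z, hz⟩ := hdvd
  have hn0 : (0 : ℝ) < n := by exact_mod_cast hn
  refine (distInt_le_abs_sub _ z).trans ?_
  rw [le_div_iff₀ hn0]
  have hz' : (∑ i, (w i : ℝ) * round (n * α i)) = n * z := by exact_mod_cast hz
  have e : |∑ i, (w i : ℝ) * α i - z| * n = |∑ i, (w i : ℝ) * (n * α i - round (n * α i))| := by
    rw [← abs_of_pos hn0, ← abs_mul, abs_of_pos hn0]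
    congr 1
    simp only [mul_sub, Finset.sum_sub_distrib, hz', sub_mul, Finset.sum_mul]
    rw [mul_comm (z : ℝ)]
    congr 1
    exact Finset.sum_congr rfl fun i _ => by ring
  rw [e]
  calc _ ≤ ∑ i, |(w i : ℝ) * (n * α i - round (n * α i))| := Finset.abs_sum_le_sum_abs _ _
    _ ≤ ∑ _i : Fin d, σ := Finset.sum_le_sum fun i _ => by
        rw [abs_mul]
        exact hw i
    _ = d * σ := by simp

/-- Put `p i = round (n * α i)`. Among vectors with `0 ≤ u i ≤ σ / distInt (n * α i)`, two agree
modulo `n` on `∑ u i * p i`. Their difference `w` satisfies `distInt (∑ w i * α i) ≤ d * σ / n` and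
has height at most `2 * n`, so `c ≤ 2 * d * σ`, where `σ ^ d` is at most twice the product to be
bounded. -/
lemma IsBadLinearForm.isBadTuple {d : ℕ} (hd : 1 ≤ d) {α : Fin d → ℝ} {c : ℝ}
    (hc : 0 < c) (h : IsBadLinearForm α c) : IsBadTuple α ((c / (2 * d)) ^ d / 2) := by
  intro n hn
  have hn0 : (0 : ℝ) < n := by exact_mod_cast hn
  have hd0 : (0 : ℝ) < d := by exact_mod_cast hd
  have hδ : ∀ i, 0 < distInt (n * α i) := h.distInt_mul_pos hc hn
  set ε := n * ∏ i, distInt (n * α i) with hε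
  have hprod : 0 < ∏ i, distInt (n * α i) := Finset.prod_pos fun i _ => hδ i
  have hε0 : 0 < ε := mul_pos hn0 hprod
  obtain ⟨T, hT, hTd⟩ : ∃ T : ℝ, 0 ≤ T ∧ T ^ d = 2 * ε :=
    ⟨(2 * ε) ^ (d⁻¹ : ℝ), by positivity, Real.rpow_inv_natCast_pow (by positivity) (by omega)⟩
  set g : ℝ → ℝ := fun σ => ∏ i, max 1 (σ / distInt (n * α i)) with hg
  have hgc : Continuous g :=
    continuous_finsetProd _ fun i _ => continuous_const.max (continuous_id.div_const _)
  have hg0 : g 0 = 1 := by simp [hg]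
  have hgT : 2 * n ≤ g T := by
    calc (2 * n : ℝ) = ∏ i, T / distInt (n * α i) := by
          rw [Finset.prod_div_distrib, Finset.prod_const, Finset.card_univ, Fintype.card_fin, hTd,
            hε]
          field_simp
      _ ≤ g T := Finset.prod_le_prod (fun i _ => div_nonneg hT (hδ i).le)
          fun i _ => le_max_right _ _
  have h2n : (1 : ℝ) ≤ 2 * n := by
    have : (1 : ℝ) ≤ n := by exact_mod_cast hn
    linarith
  -- Continuity gives a `σ ≤ T` for which the height bound is exactly `2 * n`, enough to outnumber
  -- the residues.
  obtain ⟨σ, ⟨hσ0, hσT⟩, hσ⟩ := intermediate_value_Icc hT hgc.continuousOn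
    (Set.mem_Icc.2 ⟨hg0.le.trans h2n, hgT⟩)
  set S := Fintype.piFinset fun i : Fin d =>
    Finset.Icc (0 : ℤ) ⌊σ / distInt (n * α i)⌋ with hS
  have hfl : ∀ i, 0 ≤ ⌊σ / distInt (n * α i)⌋ := fun i =>
    Int.floor_nonneg.2 (div_nonneg hσ0 (hδ i).le)
  have hcard : (Finset.Ico (0 : ℤ) n).card < S.card := by
    have h1 : (2 * n : ℝ) ≤ S.card := by
      rw [← hσ, hS, Fintype.card_piFinset]
      push_cast
      refine Finset.prod_le_prod (fun i _ => by positivity) fun i _ => ?_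
      have e : ((⌊σ / distInt (n * α i)⌋ + 1).toNat : ℝ) = ⌊σ / distInt (n * α i)⌋ + 1 := by
        exact_mod_cast congrArg (Int.cast : ℤ → ℝ)
          (Int.toNat_of_nonneg (by have := hfl i; omega : 0 ≤ ⌊σ / distInt (n * α i)⌋ + 1))
      rw [Int.card_Icc, sub_zero, e]
      refine max_le ?_ (Int.lt_floor_add_one _).le
      have : (0 : ℝ) ≤ ⌊σ / distInt (n * α i)⌋ := by exact_mod_cast hfl i
      linarith
    have h2 : 2 * n ≤ S.card := by exact_mod_cast h1
    simp only [Int.card_Ico, sub_zero, Int.toNat_natCast]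
    omega
  obtain ⟨u, hu, u', hu', hne, heq⟩ := Finset.exists_ne_map_eq_of_card_lt_of_maps_to hcard
    (f := fun u : Fin d → ℤ => (∑ i, u i * round (n * α i)) % n) (fun u _ => by
      have hn' : (0 : ℤ) < n := by exact_mod_cast hn
      simpa using ⟨Int.emod_nonneg _ hn'.ne', Int.emod_lt_of_pos _ hn'⟩)
  rw [hS, Fintype.mem_piFinset] at hu hu'
  have hw : ∀ i, |((u - u') i : ℝ)| ≤ σ / distInt (n * α i) := by
    intro i
    have h1 := Finset.mem_Icc.1 (hu i)
    have h2 := Finset.mem_Icc.1 (hu' i)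
    have h3 : |(u - u') i| ≤ ⌊σ / distInt (n * α i)⌋ := by
      rw [abs_le, Pi.sub_apply]
      constructor <;> omega
    calc |((u - u') i : ℝ)| = ((|(u - u') i| : ℤ) : ℝ) := by push_cast; rfl
      _ ≤ ⌊σ / distInt (n * α i)⌋ := by exact_mod_cast h3
      _ ≤ _ := Int.floor_le _
  have hdist := distInt_sum_le (α := α) hn (w := u - u') (σ := σ)
    (fun i => by
      have := hw i
      rwa [le_div_iff₀ (hδ i)] at this)
    (by
      have := Int.ModEq.dvd (Int.ModEq.symm heq)
      simpa [sub_mul, Finset.sum_sub_distrib] using this)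
  have hbad := h (u - u') (sub_ne_zero.2 hne)
  have hle : ∏ i, max 1 |((u - u') i : ℝ)| ≤ 2 * n := by
    rw [← hσ]
    exact Finset.prod_le_prod (fun i _ => by positivity) fun i _ => max_le_max_left _ (hw i)
  have h1 : c ≤ 2 * n * (d * σ / n) :=
    hbad.trans (mul_le_mul hle hdist (distInt_nonneg _) (by positivity))
  have h2 : 2 * n * (d * σ / n) = 2 * d * σ := by field_simp
  have h3 : c / (2 * d) ≤ T := by
    rw [div_le_iff₀ (by positivity)]
    nlinarith
  have h4 := pow_le_pow_left₀ (by positivity) h3 d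
  linarith

/-- Two of the multiples `0, α, …, (∏ i, M i) α` lie in the same box of the grid on the torus with
`M i` cells in the `i`-th direction. -/
lemma exists_mul_near_int {d : ℕ} (α : Fin d → ℝ) (M : Fin d → ℕ) (hM : ∀ i, 0 < M i) :
    ∃ (q : ℕ) (p : Fin d → ℤ), 1 ≤ q ∧ q ≤ ∏ i, M i ∧
      ∀ i, |q * α i - p i| * M i < 1 := by
  have hcard : (Fintype.piFinset fun i : Fin d => Finset.Ico (0 : ℤ) (M i)).card <
      (Finset.range (∏ i, M i + 1)).card := by
    simp [Fintype.card_piFinset]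
  obtain ⟨n, hn, n', hn', hne, heq⟩ := Finset.exists_ne_map_eq_of_card_lt_of_maps_to hcard
    (f := fun (n : ℕ) (i : Fin d) => ⌊Int.fract (n * α i) * M i⌋) (fun n _ => by
      rw [Finset.mem_coe, Fintype.mem_piFinset]
      intro i
      have hMi : (0 : ℝ) < M i := by exact_mod_cast hM i
      rw [Finset.mem_Ico]
      refine ⟨Int.floor_nonneg.2 (mul_nonneg (Int.fract_nonneg _) hMi.le), Int.floor_lt.2 ?_⟩
      push_cast
      exact mul_lt_of_lt_one_left hMi (Int.fract_lt_one _))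
  have key : ∀ a b : ℕ, a < b → b ≤ ∏ i, M i →
      (fun i : Fin d => ⌊Int.fract (a * α i) * M i⌋) =
        (fun i : Fin d => ⌊Int.fract (b * α i) * M i⌋) →
      ∃ (q : ℕ) (p : Fin d → ℤ), 1 ≤ q ∧ q ≤ ∏ i, M i ∧ ∀ i, |q * α i - p i| * M i < 1 := by
    intro a b hab hb heq
    refine ⟨b - a, fun i => ⌊b * α i⌋ - ⌊a * α i⌋, by omega, by omega, fun i => ?_⟩
    have h1 := Int.abs_sub_lt_one_of_floor_eq_floor (congrFun heq i)
    have hMi : (0 : ℝ) ≤ M i := Nat.cast_nonneg _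
    rw [abs_sub_comm, ← sub_mul, abs_mul, abs_of_nonneg hMi] at h1
    have e : ((b - a : ℕ) : ℝ) * α i - ((⌊b * α i⌋ - ⌊a * α i⌋ : ℤ) : ℝ) =
        Int.fract (b * α i) - Int.fract (a * α i) := by
      rw [Nat.cast_sub hab.le, Int.fract, Int.fract]
      push_cast
      ring
    rw [e]
    exact h1
  rw [Finset.mem_range] at hn hn'
  rcases lt_or_gt_of_ne hne with hlt | hlt
  · exact key n n' hlt (by omega) heq
  · exact key n' n hlt (by omega) heq.symm

/-- A vector `u` violating the bound is turned into a `q` with small product. Dirichlet's theorem in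
a box adapted to `u` controls `q * α i` well for `i ≠ i₀` and only crudely for `i₀`; the near
relation `∑ u i * α i ≈ round S` then improves the remaining coordinate. -/
lemma IsBadTuple.exists_isBadLinearForm {d : ℕ} {α : Fin d → ℝ} {c : ℝ}
    (hc : 0 < c) (h : IsBadTuple α c) : ∃ c' : ℝ, 0 < c' ∧ IsBadLinearForm α c' := by
  -- The first bound contradicts badness at the end; the second forces the integer `K` to vanish.
  obtain ⟨T, hT⟩ := exists_nat_gt (max (2 * (d + 1) / c) (2 * (d + 1)))
  have hT1 := (le_max_left _ _).trans_lt hT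
  have hT2 := (le_max_right _ _).trans_lt hT
  have hT0 : (0 : ℝ) < T := lt_of_le_of_lt (by positivity) hT2
  have hT0' : 0 < T := by exact_mod_cast hT0
  refine ⟨1 / (2 * T ^ d), by positivity, fun u hu => ?_⟩
  by_contra hlt
  rw [not_le] at hlt
  obtain ⟨i₀, hi₀⟩ : ∃ i, u i ≠ 0 := by
    by_contra hcon
    push Not at hcon
    exact hu (funext hcon)
  set U : Fin d → ℕ := fun i => max 1 (u i).natAbs with hU
  have hUpos : ∀ i, 0 < U i := fun i => by simp [hU]
  have hUR : ∀ i, (U i : ℝ) = max 1 |(u i : ℝ)| := by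
    intro i
    simp only [hU]
    push_cast
    rw [Nat.cast_natAbs]
    push_cast
    rfl
  have huU : ∀ i, |(u i : ℝ)| ≤ U i := fun i => by rw [hUR]; exact le_max_right _ _
  have hUi₀ : (U i₀ : ℝ) = |(u i₀ : ℝ)| := by
    rw [hUR, max_eq_right]
    exact_mod_cast Int.one_le_abs hi₀
  simp only [← hUR] at hlt
  set S := ∑ i, (u i : ℝ) * α i with hS
  obtain ⟨q, p, hq1, hqM, hp⟩ := exists_mul_near_int α
    -- Using `2` instead of `T` at `i₀` saves the factor `T` in the bound for `q` that yields the
    -- contradiction.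
    (fun i => if i = i₀ then 2 * U i else T * U i)
    (fun i => by have := hUpos i; split_ifs <;> positivity)
  have hM : ((∏ i, if i = i₀ then 2 * U i else T * U i : ℕ) : ℝ) =
      2 * T ^ (d - 1) * ∏ i, (U i : ℝ) := by
    push_cast
    rw [← Finset.mul_prod_erase _ _ (Finset.mem_univ i₀),
      ← Finset.mul_prod_erase _ (fun i => (U i : ℝ)) (Finset.mem_univ i₀), if_pos rfl,
      Finset.prod_congr rfl (g := fun i => (T : ℝ) * U i)
        (fun i hi => by rw [if_neg (Finset.ne_of_mem_erase hi)]), Finset.prod_mul_distrib,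
      Finset.prod_const, Finset.card_erase_of_mem (Finset.mem_univ _), Finset.card_univ,
      Fintype.card_fin]
    ring
  have hqM' : (q : ℝ) ≤ 2 * T ^ (d - 1) * ∏ i, (U i : ℝ) := by
    rw [← hM]; exact_mod_cast hqM
  have hTd : (T : ℝ) ^ d = T * (T : ℝ) ^ (d - 1) := by
    rw [← pow_succ', Nat.sub_add_cancel (by have := i₀.2; omega)]
  have hp₀ : |q * α i₀ - p i₀| * (2 * U i₀) < 1 := by
    have := hp i₀
    simpa using this
  have hp' : ∀ i ≠ i₀, |q * α i - p i| * U i < 1 / T := by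
    intro i hi
    have := hp i
    rw [lt_div_iff₀ hT0]
    simp only [hi, if_false] at this
    push_cast at this
    linarith
  have hphi : q * distInt S ≤ 1 / T := by
    have h1 := mul_le_mul_of_nonneg_right hqM' (distInt_nonneg S)
    have h2 : 2 * (T : ℝ) ^ (d - 1) * ((∏ i, (U i : ℝ)) * distInt S) ≤
        2 * T ^ (d - 1) * (1 / (2 * T ^ d)) :=
      mul_le_mul_of_nonneg_left hlt.le (by positivity)
    have h3 : 2 * (T : ℝ) ^ (d - 1) * (1 / (2 * T ^ d)) = 1 / T := by
      rw [hTd]; field_simp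
    linarith
  set R := ∑ i ∈ Finset.univ.erase i₀, (u i : ℝ) * (q * α i - p i) with hR
  have hRle : |R| ≤ d / T := by
    calc |R| ≤ ∑ i ∈ Finset.univ.erase i₀, |(u i : ℝ) * (q * α i - p i)| :=
          Finset.abs_sum_le_sum_abs _ _
      _ ≤ ∑ i ∈ Finset.univ.erase i₀, 1 / (T : ℝ) := Finset.sum_le_sum fun i hi => by
          rw [abs_mul]
          have h1 := hp' i (Finset.ne_of_mem_erase hi)
          have h2 := mul_le_mul_of_nonneg_right (huU i) (abs_nonneg (q * α i - p i))
          linarith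
      _ ≤ ∑ i : Fin d, 1 / (T : ℝ) :=
          Finset.sum_le_sum_of_subset_of_nonneg (Finset.erase_subset _ _)
            fun _ _ _ => by positivity
      _ = d / T := by simp [div_eq_mul_inv]
  set K : ℤ := q * round S - ∑ i, u i * p i with hK
  have hsplit : (u i₀ : ℝ) * (q * α i₀ - p i₀) + R = K + q * (S - round S) := by
    rw [hR, Finset.add_sum_erase _ (fun i => (u i : ℝ) * (q * α i - p i)) (Finset.mem_univ i₀), hK]
    push_cast
    simp only [mul_sub, Finset.sum_sub_distrib, hS, Finset.mul_sum]
    have : ∀ i, (u i : ℝ) * (q * α i) = q * (u i * α i) := fun i => by ring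
    simp only [this]
    ring
  have habs : |q * (S - round S)| ≤ 1 / T := by
    rw [abs_mul, Nat.abs_cast]; exact hphi
  have hsum : (d : ℝ) / T + 1 / T < 1 / 2 := by
    rw [← add_div, div_lt_div_iff₀ hT0 two_pos]
    linarith
  have hu₀ : |(u i₀ : ℝ) * (q * α i₀ - p i₀)| < 1 / 2 := by
    rw [abs_mul, ← hUi₀]
    linarith
  have hK0 : K = 0 := by
    have h1 : |(K : ℝ)| < 1 := by
      have : (K : ℝ) = (u i₀ : ℝ) * (q * α i₀ - p i₀) + R - q * (S - round S) := by
        rw [hsplit]; ring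
      rw [this]
      rw [abs_lt] at hu₀ ⊢
      rw [abs_le] at hRle habs
      constructor <;> linarith [hu₀.1, hu₀.2, hRle.1, hRle.2, habs.1, habs.2]
    rw [← Int.abs_lt_one_iff]
    exact_mod_cast h1
  -- With `K = 0` the `i₀` term equals a difference of small quantities.
  have hfin₀ : |q * α i₀ - p i₀| * U i₀ ≤ (d + 1) / T := by
    rw [hUi₀, ← abs_mul, mul_comm, add_div]
    have : (u i₀ : ℝ) * (q * α i₀ - p i₀) = q * (S - round S) - R := by
      rw [hK0] at hsplit
      push_cast at hsplit
      linarith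
    rw [this, abs_le]
    rw [abs_le] at hRle habs
    constructor <;> linarith [hRle.1, hRle.2, habs.1, habs.2]
  have hdist : ∀ i, distInt (q * α i) * U i ≤ (if i = i₀ then ((d : ℝ) + 1) / T else 1 / T) := by
    intro i
    have h1 := mul_le_mul_of_nonneg_right (distInt_le_abs_sub (q * α i) (p i))
      (Nat.cast_nonneg (α := ℝ) (U i))
    split_ifs with hi
    · subst hi; exact h1.trans hfin₀
    · exact h1.trans (hp' i hi).le
  have hprod : (∏ i, distInt (q * α i)) * ∏ i, (U i : ℝ) ≤ (d + 1) / T ^ d := by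
    rw [← Finset.prod_mul_distrib]
    refine (Finset.prod_le_prod (fun i _ => mul_nonneg (distInt_nonneg _) (Nat.cast_nonneg _))
      fun i _ => hdist i).trans ?_
    rw [← Finset.mul_prod_erase _ _ (Finset.mem_univ i₀), if_pos rfl,
      Finset.prod_congr rfl (g := fun _ => 1 / (T : ℝ))
        (fun i hi => by rw [if_neg (Finset.ne_of_mem_erase hi)]),
      Finset.prod_const, Finset.card_erase_of_mem (Finset.mem_univ _), Finset.card_univ,
      Fintype.card_fin, hTd, one_div, inv_pow]
    apply le_of_eq
    field_simp
  have hbad := h q hq1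
  have hP0 : 0 ≤ ∏ i, distInt (q * α i) := Finset.prod_nonneg fun i _ => distInt_nonneg _
  have h1 := mul_le_mul_of_nonneg_right hqM' hP0
  have h2 : 2 * (T : ℝ) ^ (d - 1) * ((∏ i, distInt (q * α i)) * ∏ i, (U i : ℝ)) ≤
      2 * T ^ (d - 1) * ((d + 1) / T ^ d) := mul_le_mul_of_nonneg_left hprod (by positivity)
  have h3 : 2 * (T : ℝ) ^ (d - 1) * ((d + 1) / T ^ d) = 2 * (d + 1) / T := by
    rw [hTd]; field_simp
  have h4 : c ≤ 2 * (d + 1) / T := by linarith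
  rw [div_lt_iff₀ hc] at hT1
  rw [le_div_iff₀ hT0] at h4
  linarith

/-! ### Inhomogeneous approximation by a badly approximable linear form -/

lemma IsBadLinearForm.le_half {d : ℕ} (hd : 1 ≤ d) {α : Fin d → ℝ} {c : ℝ}
    (h : IsBadLinearForm α c) : c ≤ 1 / 2 := by
  have h1 := h (Pi.single ⟨0, hd⟩ 1) (by simp [Pi.single_eq_zero_iff])
  have h2 : ∏ i, max 1 |((Pi.single ⟨0, hd⟩ 1 : Fin d → ℤ) i : ℝ)| = 1 := by
    refine Finset.prod_eq_one fun i _ => ?_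
    by_cases hi : i = ⟨0, hd⟩
    · subst hi; simp
    · simp [hi]
  rw [h2, one_mul] at h1
  exact h1.trans (distInt_le_half _)

lemma IsBadLinearForm.le_pow_mul_distInt {d : ℕ} {α : Fin d → ℝ} {c : ℝ}
    (h : IsBadLinearForm α c) {R : ℕ} (hR : 1 ≤ R) {u : Fin d → ℤ} (hu : u ≠ 0)
    (huR : ∀ i, |u i| ≤ R) : c ≤ (R : ℝ) ^ d * distInt (∑ i, u i * α i) := by
  refine (h u hu).trans (mul_le_mul_of_nonneg_right ?_ (distInt_nonneg _))
  calc ∏ i, max 1 |(u i : ℝ)| ≤ ∏ _i : Fin d, (R : ℝ) :=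
        Finset.prod_le_prod (fun i _ => by positivity) fun i _ =>
          max_le (by exact_mod_cast hR) (by exact_mod_cast huR i)
    _ = (R : ℝ) ^ d := by simp

/-- Inhomogeneous approximation, by the pigeonhole principle for the points
`r γ / h! + ∑ i, u i α i` with `0 ≤ r ≤ h` and `0 ≤ u i < R`. -/
lemma IsBadLinearForm.exists_near {d : ℕ} {α : Fin d → ℝ} {c : ℝ} (hc : 0 < c)
    (hbad : IsBadLinearForm α c) {h : ℕ} (hh : 1 / c ≤ h) {R : ℕ} (hR : 1 ≤ R) (γ : ℝ) :
    ∃ (m : Fin d → ℤ) (z : ℤ), (∀ i, |m i| ≤ h.factorial * R) ∧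
      |∑ i, m i * α i - γ - z| ≤ h.factorial * c / R ^ d := by
  have hR0 : (0 : ℝ) < R := by exact_mod_cast hR
  have hh0 : (0 : ℝ) < h := lt_of_lt_of_le (by positivity) hh
  have hh0' : 0 < h := by exact_mod_cast hh0
  have hH0 : (0 : ℝ) < h.factorial := by exact_mod_cast h.factorial_pos
  set Q : ℕ := h * R ^ d with hQ
  have hQ0 : (0 : ℝ) < Q := by rw [hQ]; push_cast; positivity
  have hQc : 1 / (Q : ℝ) ≤ c / R ^ d := by
    rw [div_le_div_iff₀ hQ0 (by positivity), hQ, one_mul]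
    push_cast
    rw [div_le_iff₀ hc] at hh
    have : 0 < (R : ℝ) ^ d := by positivity
    nlinarith
  set S := Finset.range (h + 1) ×ˢ Fintype.piFinset fun _ : Fin d => Finset.Ico (0 : ℤ) R with hS
  set P : ℕ × (Fin d → ℤ) → ℝ := fun x => x.1 * (γ / h.factorial) + ∑ i, x.2 i * α i with hP
  -- There are `(h + 1) * R ^ d` points for `h * R ^ d` cells.
  have hcard : (Finset.Ico (0 : ℤ) Q).card < S.card := by
    have : 0 < R ^ d := by positivity
    simp only [hS, Finset.card_product, Fintype.card_piFinset_const, Finset.card_range,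
      Int.card_Ico, sub_zero, Int.toNat_natCast, hQ]
    nlinarith
  obtain ⟨x, hx, x', hx', hne, heq⟩ := Finset.exists_ne_map_eq_of_card_lt_of_maps_to hcard
    (f := fun x => ⌊Int.fract (P x) * Q⌋) (fun x _ => by
      rw [Finset.mem_coe, Finset.mem_Ico]
      refine ⟨Int.floor_nonneg.2 (mul_nonneg (Int.fract_nonneg _) hQ0.le), Int.floor_lt.2 ?_⟩
      push_cast
      exact mul_lt_of_lt_one_left hQ0 (Int.fract_lt_one _))
  have hclose : ∀ x x' : ℕ × (Fin d → ℤ), ⌊Int.fract (P x) * Q⌋ = ⌊Int.fract (P x') * Q⌋ →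
      |P x - P x' - ((⌊P x⌋ - ⌊P x'⌋ : ℤ) : ℝ)| < 1 / Q := by
    intro x x' heq
    have h1 := Int.abs_sub_lt_one_of_floor_eq_floor heq
    rw [← sub_mul, abs_mul, abs_of_pos hQ0, ← lt_div_iff₀ hQ0] at h1
    have e : P x - P x' - ((⌊P x⌋ - ⌊P x'⌋ : ℤ) : ℝ) = Int.fract (P x) - Int.fract (P x') := by
      rw [Int.fract, Int.fract]
      push_cast
      ring
    rwa [e]
  have hPsub : ∀ x x' : ℕ × (Fin d → ℤ), P x - P x' =
      ((x.1 : ℝ) - x'.1) * (γ / h.factorial) + ∑ i, ((x.2 - x'.2) i : ℝ) * α i := by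
    intro x x'
    simp only [hP, Pi.sub_apply, Int.cast_sub, sub_mul, Finset.sum_sub_distrib]
    ring
  have hbound : ∀ x ∈ S, ∀ x' ∈ S, ∀ i, |(x.2 - x'.2) i| ≤ R := by
    intro x hx x' hx' i
    simp only [hS, Finset.mem_product, Fintype.mem_piFinset, Finset.mem_Ico] at hx hx'
    have h1 := hx.2 i
    have h2 := hx'.2 i
    rw [abs_le, Pi.sub_apply]
    constructor <;> omega
  have key : ∀ x ∈ S, ∀ x' ∈ S, ⌊Int.fract (P x) * Q⌋ = ⌊Int.fract (P x') * Q⌋ → x'.1 < x.1 →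
      ∃ (m : Fin d → ℤ) (z : ℤ), (∀ i, |m i| ≤ h.factorial * R) ∧
        |∑ i, m i * α i - γ - z| ≤ h.factorial * c / R ^ d := by
    intro x hx x' hx' heq hlt
    have hxh : x.1 ≤ h := by
      simp only [hS, Finset.mem_product, Finset.mem_range] at hx
      omega
    -- Multiplying by the cofactor `e` makes the coefficient of `γ` equal to `1`, whatever the
    -- difference of the two `r` is.
    obtain ⟨e, he⟩ : x.1 - x'.1 ∣ h.factorial := Nat.dvd_factorial (by omega) (by omega)
    have heH : e ≤ h.factorial := Nat.le_of_dvd h.factorial_pos ⟨x.1 - x'.1, by rw [he, mul_comm]⟩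
    have h1 := hclose x x' heq
    rw [hPsub] at h1
    generalize ⌊P x⌋ - ⌊P x'⌋ = z at h1
    refine ⟨fun i => -(e * (x.2 - x'.2) i), -(e * z), fun i => ?_, ?_⟩
    · rw [abs_neg, abs_mul, Nat.abs_cast]
      exact mul_le_mul (by exact_mod_cast heH) (hbound x hx x' hx' i) (abs_nonneg _)
        (by positivity)
    · have hγ : (e : ℝ) * (((x.1 : ℝ) - x'.1) * (γ / h.factorial)) = γ := by
        have : (h.factorial : ℝ) = ((x.1 : ℝ) - x'.1) * e := by
          rw [he, Nat.cast_mul, Nat.cast_sub hlt.le]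
        rw [← mul_assoc, mul_comm (e : ℝ), ← this]
        field_simp
      have e1 : ∑ i, ((-(e * (x.2 - x'.2) i) : ℤ) : ℝ) * α i - γ - ((-(e * z) : ℤ) : ℝ) =
          -(e * (((x.1 : ℝ) - x'.1) * (γ / h.factorial) + ∑ i, ((x.2 - x'.2) i : ℝ) * α i - z)) := by
        rw [mul_sub, mul_add, hγ, Finset.mul_sum]
        push_cast
        simp only [neg_mul, Finset.sum_neg_distrib, mul_assoc]
        ring
      rw [e1, abs_neg, abs_mul, Nat.abs_cast, mul_div_assoc]
      exact mul_le_mul (by exact_mod_cast heH) (h1.le.trans hQc) (abs_nonneg _) hH0.le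
  rcases lt_trichotomy x.1 x'.1 with hlt | heq1 | hlt
  · exact key x' hx' x hx heq.symm hlt
  -- With equal `r`, a nonzero vector of size at most `R` would have a value within `1 / Q ≤ c / R ^
  -- d` of an integer.
  · exfalso
    have hu : x.2 - x'.2 ≠ 0 := sub_ne_zero.2 fun h2 => hne (Prod.ext heq1 h2)
    have h1 := hbad.le_pow_mul_distInt hR hu (hbound x hx x' hx')
    have h2 := hclose x x' heq
    rw [hPsub, heq1, sub_self, zero_mul, zero_add] at h2
    have h3 := ((distInt_le_abs_sub _ _).trans_lt h2).trans_le hQc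
    rw [lt_div_iff₀ (by positivity)] at h3
    linarith
  · exact key x hx x' hx' heq hlt

lemma IsBadLinearForm.exists_inhomogeneous {d : ℕ} (hd : 1 ≤ d) {α : Fin d → ℝ} {c : ℝ}
    (hc : 0 < c) (hbad : IsBadLinearForm α c) {η : ℝ} (hη : 0 < η) :
    ∃ A : ℝ, 0 < A ∧ ∀ l : ℝ, 1 ≤ l → ∀ (γ : ℝ) (x : Fin d → ℝ), ∃ (m : Fin d → ℤ) (z : ℤ),
      (∀ i, |(m i : ℝ) - x i| ≤ A * l) ∧ |∑ i, m i * α i - γ - z| < η / l ^ d := by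
  obtain ⟨h, hh⟩ := exists_nat_ge (1 / c)
  set H : ℝ := (h.factorial : ℝ) with hH
  have hH0 : 0 < H := by rw [hH]; exact_mod_cast h.factorial_pos
  -- Chosen so that `H * c < η * B ≤ η * B ^ d`.
  set B : ℝ := 1 + H * c / η with hB
  have hB0 : 0 < H * c / η := by positivity
  have hB1 : 1 ≤ B := by linarith
  refine ⟨H * (B + 1) + 1, by positivity, fun l hl γ x => ?_⟩
  set R := ⌈B * l⌉₊ with hR
  have hBl : 1 ≤ B * l := one_le_mul_of_one_le_of_one_le hB1 hl
  have hRge : B * l ≤ R := Nat.le_ceil _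
  have hRle : (R : ℝ) < B * l + 1 := Nat.ceil_lt_add_one (by linarith)
  have hR1 : 1 ≤ R := by
    have : (1 : ℝ) ≤ R := hBl.trans hRge
    exact_mod_cast this
  obtain ⟨m, z, hm, hz⟩ := hbad.exists_near hc hh hR1 (γ - ∑ i, (round (x i) : ℝ) * α i)
  refine ⟨fun i => m i + round (x i), z, fun i => ?_, ?_⟩
  · have h1 : |(m i : ℝ)| ≤ H * R := by rw [hH]; exact_mod_cast hm i
    have h2 := abs_sub_round (x i)
    have h3 : H * R ≤ H * ((B + 1) * l) := mul_le_mul_of_nonneg_left (by linarith) hH0.le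
    push_cast
    rw [abs_le] at *
    constructor <;> linarith [h1.1, h1.2, h2.1, h2.2]
  · have e : ∑ i, ((m i + round (x i) : ℤ) : ℝ) * α i - γ - z =
        ∑ i, m i * α i - (γ - ∑ i, (round (x i) : ℝ) * α i) - z := by
      push_cast
      simp only [add_mul, Finset.sum_add_distrib]
      ring
    rw [e]
    refine hz.trans_lt ?_
    have hl0 : 0 < l := by linarith
    have hR0 : (0 : ℝ) < R := by exact_mod_cast hR1
    rw [div_lt_div_iff₀ (by positivity) (by positivity)]
    have h1 : (B * l) ^ d ≤ (R : ℝ) ^ d := pow_le_pow_left₀ (by positivity) hRge d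
    rw [mul_pow] at h1
    have h2 : B ≤ B ^ d := le_self_pow₀ hB1 (by omega)
    have hld : 0 < l ^ d := by positivity
    have h3 : H * c < η * B := by
      rw [hB, mul_add, mul_div_cancel₀ _ hη.ne']
      linarith
    calc H * c * l ^ d < η * B * l ^ d := mul_lt_mul_of_pos_right h3 hld
      _ ≤ η * (B ^ d * l ^ d) := by
        rw [mul_assoc]
        exact mul_le_mul_of_nonneg_left (mul_le_mul_of_nonneg_right h2 hld.le) hη.le
      _ ≤ η * (R : ℝ) ^ d := mul_le_mul_of_nonneg_left h1 hη.le

/-! ### From badly approximable linear forms to linear repetitivity -/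

/-- Complement of `floor_sub_ne`: within `[0, 1)` there is only one wall for each `t`. -/
lemma floor_sub_eq_of_iff {w w' t : ℝ} (hw : 0 ≤ w) (hw1 : w < 1) (hw' : 0 ≤ w') (hw1' : w' < 1)
    (h : Int.fract t ≤ w ↔ Int.fract t ≤ w') : ⌊w - t⌋ = ⌊w' - t⌋ := by
  have e : ∀ v : ℝ, 0 ≤ v → v < 1 →
      ⌊v - t⌋ = (if Int.fract t ≤ v then 0 else -1) - ⌊t⌋ := by
    intro v hv hv1
    have h0 := Int.fract_nonneg t
    have h1 := Int.fract_lt_one t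
    have : v - t = v - Int.fract t - ⌊t⌋ := by rw [Int.fract]; ring
    rw [this, Int.floor_sub_intCast]
    congr 1
    split_ifs with hle
    · exact Int.floor_eq_iff.2 ⟨by push_cast; linarith, by push_cast; linarith⟩
    · exact Int.floor_eq_iff.2 ⟨by push_cast; linarith, by push_cast; linarith⟩
  rw [e w hw hw1, e w' hw' hw1']
  simp only [h]

/-- The arc of the partition given by the points of a rectangle that contains `w`. -/
lemma IsBadLinearForm.exists_arc {d : ℕ} (hd : 1 ≤ d) {α : Fin d → ℝ} {c : ℝ}
    (hbad : IsBadLinearForm α c) {a b : Fin d → ℤ} (hab : ∀ i, a i < b i)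
    (hab0 : ∀ i, a i ≤ 0 ∧ 0 ≤ b i) {w : ℝ} (hw : 0 ≤ w) (hw1 : w < 1) :
    ∃ p q : ℝ, 0 ≤ p ∧ q ≤ 1 ∧ c ≤ (∏ i, ((b i : ℝ) - a i)) * (q - p) ∧
      ∀ w', p < w' → w' < q → ∀ u : Fin d → ℤ, (∀ i, a i ≤ u i ∧ u i ≤ b i) →
        ⌊w - ∑ i, u i * α i⌋ = ⌊w' - ∑ i, u i * α i⌋ := by
  classical
  set L : (Fin d → ℤ) → ℝ := fun u => ∑ i, u i * α i with hL
  have hL0 : L 0 = 0 := by simp [hL]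
  have hLsub : ∀ u v, L (u - v) = L u - L v := by
    intro u v
    simp [hL, sub_mul]
  have h1V : ∀ i, (1 : ℝ) ≤ (b i : ℝ) - a i := by
    intro i
    have : (a i : ℝ) + 1 ≤ b i := by exact_mod_cast hab i
    linarith
  have hV : 1 ≤ ∏ i, ((b i : ℝ) - a i) := one_le_prod_of_one_le h1V
  set X : Finset (Fin d → ℤ) := Fintype.piFinset fun i => Finset.Icc (a i) (b i) with hX
  have hmem : ∀ u, u ∈ X ↔ ∀ i, a i ≤ u i ∧ u i ≤ b i := by
    intro u
    simp [hX, Fintype.mem_piFinset]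
  have h0X : (0 : Fin d → ℤ) ∈ X := (hmem 0).2 hab0
  obtain ⟨u₁, hu₁, hmax⟩ := Finset.exists_max_image
    (X.filter fun u => Int.fract (L u) ≤ w) (fun u => Int.fract (L u))
    ⟨0, Finset.mem_filter.2 ⟨h0X, by simpa [hL0] using hw⟩⟩
  rw [Finset.mem_filter] at hu₁
  -- If no wall lies to the right of `w`, the endpoint is `1`, the wall of `u = 0` seen once around
  -- the circle. In either case the arc length is congruent to `L (u₂ - u₁)` modulo `1`.
  have hq : ∃ (q : ℝ) (u₂ : Fin d → ℤ), u₂ ∈ X ∧ w < q ∧ q ≤ 1 ∧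
      (q = Int.fract (L u₂) ∨ q = 1 ∧ u₂ = 0) ∧ ∀ u ∈ X, w < Int.fract (L u) → q ≤ Int.fract (L u) := by
    by_cases hne : (X.filter fun u => w < Int.fract (L u)).Nonempty
    · obtain ⟨u₂, hu₂, hmin⟩ := Finset.exists_min_image _ (fun u => Int.fract (L u)) hne
      rw [Finset.mem_filter] at hu₂
      exact ⟨_, u₂, hu₂.1, hu₂.2, (Int.fract_lt_one _).le, Or.inl rfl,
        fun u hu hwu => hmin u (Finset.mem_filter.2 ⟨hu, hwu⟩)⟩
    · refine ⟨1, 0, h0X, hw1, le_rfl, Or.inr ⟨rfl, rfl⟩, fun u hu hwu => ?_⟩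
      exact absurd ⟨u, Finset.mem_filter.2 ⟨hu, hwu⟩⟩ hne
  obtain ⟨q, u₂, hu₂, hwq, hq1, hqu, hmin⟩ := hq
  refine ⟨Int.fract (L u₁), q, Int.fract_nonneg _, hq1, ?_, ?_⟩
  · have hpq : Int.fract (L u₁) < q := hu₁.2.trans_lt hwq
    -- Equality occurs only if the arc is all of `[0, 1)`.
    by_cases hu : u₂ = u₁
    · subst hu
      rcases hqu with h1 | ⟨h1, h2⟩
      · exact absurd h1 hpq.ne'
      · rw [h1, h2, hL0, Int.fract_zero, sub_zero, mul_one]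
        linarith [hbad.le_half hd]
    · refine (hbad (u₂ - u₁) (sub_ne_zero.2 hu)).trans ?_
      refine mul_le_mul (Finset.prod_le_prod (fun i _ => by positivity) fun i _ =>
        max_le (h1V i) ?_) ?_ (distInt_nonneg _) (by linarith)
      · have h1 := (hmem _).1 hu₁.1 i
        have h2 := (hmem _).1 hu₂ i
        have h3 : |(u₂ - u₁) i| ≤ b i - a i := by
          rw [abs_le, Pi.sub_apply]
          constructor <;> omega
        exact_mod_cast h3
      · have hz : ∃ z : ℤ, L (u₂ - u₁) - z = q - Int.fract (L u₁) := by
          rw [hLsub]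
          rcases hqu with h1 | ⟨h1, h2⟩
          · refine ⟨⌊L u₂⌋ - ⌊L u₁⌋, ?_⟩
            rw [h1, Int.fract, Int.fract]
            push_cast
            ring
          · refine ⟨-1 - ⌊L u₁⌋, ?_⟩
            rw [h1, h2, hL0, Int.fract]
            push_cast
            ring
        obtain ⟨z, hz⟩ := hz
        have := distInt_le_abs_sub (L (u₂ - u₁)) z
        rwa [hz, abs_of_pos (by linarith)] at this
  · intro w' hpw hwq' u hu
    refine floor_sub_eq_of_iff hw hw1 ((Int.fract_nonneg _).trans hpw.le) (by linarith) ?_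
    constructor
    · intro hle
      exact (hmax u (Finset.mem_filter.2 ⟨(hmem u).2 hu, hle⟩)).trans hpw.le
    · intro hle
      by_contra hcon
      linarith [hmin u ((hmem u).2 hu) (not_le.1 hcon)]

/-- Arcs have length at least `c / l ^ d`, so inhomogeneous approximation of the midpoint with error
below `c / (2 * l ^ d)` lands inside. -/
lemma Data.exists_recursWith_of_isBadLinearForm {k d : ℕ} (D : Data k d) (h : d ≤ k) (hd : 1 ≤ d)
    {j : Fin k} (huniq : ∀ j' : Fin k, d ≤ (j' : ℕ) → j' = j) {c : ℝ} (hc : 0 < c)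
    (hbad : IsBadLinearForm (D.coeff j) c) : ∃ A : ℝ, 0 < A ∧ D.RecursWith h A := by
  obtain ⟨A, hA, H⟩ := hbad.exists_inhomogeneous hd hc (half_pos hc)
  refine ⟨A, hA, fun a b hab hab0 l hl hlV m x => ?_⟩
  obtain ⟨p, q, hp, hq, hpq, harc⟩ := hbad.exists_arc hd hab hab0 (D.phase_nonneg h j m)
    (D.phase_lt_one h j m)
  obtain ⟨m', z, hm', hz⟩ := H l hl (D.offset h j - (p + q) / 2) x
  refine ⟨m', hm', fun u hu j' hj' => ?_⟩
  have hslope : ∀ u : Fin d → ℤ, D.slope j (intVec u) = ∑ i, (u i : ℝ) * D.coeff j i := by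
    intro u
    rw [D.slope_eq_sum]; rfl
  rw [huniq j' hj', hslope]
  have hl0 : 0 < l ^ d := by positivity
  have hpq' : c / 2 / l ^ d ≤ (q - p) / 2 := by
    rw [div_le_iff₀ hl0, hlV]
    linarith
  have h1 := abs_lt.1 (hz.trans_le hpq')
  have hphase : D.phase h j m' = D.offset h j - D.slope j (intVec m') + z := by
    rw [Data.phase, Int.fract_eq_iff, hslope]
    exact ⟨by linarith [h1.2], by linarith [h1.1], -z, by push_cast; ring⟩
  rw [hslope] at hphase
  exact harc _ (by rw [hphase]; linarith [h1.2]) (by rw [hphase]; linarith [h1.1]) u hu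

/-! ### Cut and project sets of codimension one with prescribed slopes -/

lemma isCompl_ker_of_apply_ne_zero {V : Type*} [AddCommGroup V] [Module ℝ V] (φ : V →ₗ[ℝ] ℝ)
    (G : Submodule ℝ V) {g : V} (hg : g ∈ G) (hφ : φ g ≠ 0) (h0 : ∀ v ∈ G, φ v = 0 → v = 0) :
    IsCompl (LinearMap.ker φ) G := by
  refine ⟨Submodule.disjoint_def.2 fun v hv hvG => h0 v hvG hv, codisjoint_iff.2 ?_⟩
  refine eq_top_iff.2 fun v _ => Submodule.mem_sup.2
    ⟨v - (φ v / φ g) • g, ?_, (φ v / φ g) • g, G.smul_mem _ hg, by simp⟩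
  rw [LinearMap.mem_ker, map_sub, map_smul, smul_eq_mul, div_mul_cancel₀ _ hφ, sub_self]

section Construction

variable {d : ℕ} (α : Fin d → ℝ)

/-- The linear form with kernel the graph of `x ↦ ∑ i, α i * x i`. -/
def graphForm : (Fin (d + 1) → ℝ) →ₗ[ℝ] ℝ :=
  LinearMap.proj (Fin.last d) - ∑ i, α i • LinearMap.proj (Fin.castSucc i)

lemma graphForm_apply (v : Fin (d + 1) → ℝ) :
    graphForm α v = v (Fin.last d) - ∑ i, α i * v (Fin.castSucc i) := by
  simp [graphForm, LinearMap.sum_apply]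

/-- A normal vector of the graph. -/
def graphNormal : Fin (d + 1) → ℝ := Fin.snoc (α := fun _ => ℝ) (fun i => -α i) 1

lemma graphNormal_last : graphNormal α (Fin.last d) = 1 := by simp [graphNormal]

lemma graphNormal_castSucc (i : Fin d) : graphNormal α (Fin.castSucc i) = -α i := by
  simp [graphNormal]

lemma graphForm_graphNormal_pos : 0 < graphForm α (graphNormal α) := by
  rw [graphForm_apply, graphNormal_last]
  simp only [graphNormal_castSucc, mul_neg, Finset.sum_neg_distrib, sub_neg_eq_add]
  have : 0 ≤ ∑ i, α i * α i := Finset.sum_nonneg fun i _ => mul_self_nonneg _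
  linarith

lemma isCompl_graph_span :
    IsCompl (LinearMap.ker (graphForm α)) (Submodule.span ℝ {graphNormal α}) := by
  refine isCompl_ker_of_apply_ne_zero _ _ (Submodule.mem_span_singleton_self _)
    (graphForm_graphNormal_pos α).ne' fun v hv h0 => ?_
  obtain ⟨t, rfl⟩ := Submodule.mem_span_singleton.1 hv
  rw [map_smul, smul_eq_mul, mul_eq_zero, or_iff_left (graphForm_graphNormal_pos α).ne'] at h0
  rw [h0, zero_smul]

lemma graphForm_of_mem_ref {v : Fin (d + 1) → ℝ} (hv : v ∈ refSubspace (d + 1) d) :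
    graphForm α v = v (Fin.last d) := by
  rw [graphForm_apply, Finset.sum_eq_zero, sub_zero]
  intro i _
  rw [hv (Fin.castSucc i) i.2, mul_zero]

lemma isCompl_graph_ref : IsCompl (LinearMap.ker (graphForm α)) (refSubspace (d + 1) d) := by
  have hg : Pi.single (Fin.last d) (1 : ℝ) ∈ refSubspace (d + 1) d := by
    intro i hi
    have : i ≠ Fin.last d := by
      rintro rfl
      simp at hi
    simp [this]
  refine isCompl_ker_of_apply_ne_zero _ _ hg ?_ fun v hv h0 => ?_
  · rw [graphForm_of_mem_ref α hg]
    simp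
  · rw [graphForm_of_mem_ref α hv] at h0
    funext i
    refine Fin.lastCases h0 (fun i => ?_) i
    exact hv (Fin.castSucc i) i.2

lemma finrank_graph : Module.finrank ℝ (LinearMap.ker (graphForm α)) = d := by
  have hne : graphForm α ≠ 0 := fun h => by
    have := graphForm_graphNormal_pos α
    rw [h] at this
    simp at this
  have := Module.Dual.finrank_ker_add_one_of_ne_zero (K := ℝ) hne
  rw [Module.finrank_fin_fun] at this
  omega

lemma sum_single_mul (i : Fin d) (z : ℤ) :
    ∑ l, ((Pi.single i z : Fin d → ℤ) l : ℝ) * α l = z * α i := by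
  rw [Finset.sum_eq_single i]
  · simp
  · intro l _ hl
    simp [hl]
  · simp

/-- The cut and project data of the graph of `x ↦ ∑ i, α i * x i`, projecting orthogonally, with
cubical window and translation vector `σ` times the last basis vector. -/
def graphData (hd : 1 ≤ d) (hα : ∀ u : Fin d → ℤ, u ≠ 0 → ∀ z : ℤ, ∑ i, u i * α i ≠ z) (σ : ℝ) :
    Data (d + 1) d where
  E := LinearMap.ker (graphForm α)
  finrank_E := finrank_graph α
  F := Submodule.span ℝ {graphNormal α}
  isCompl := isCompl_graph_span α
  isCompl_ref := isCompl_graph_ref α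
  window := {v | v ∈ Submodule.span ℝ {graphNormal α} ∧ graphForm α v ∈ Set.Ico 0 1}
  window_subset := fun _ hv => hv.1
  s := Pi.single (Fin.last d) σ
  injective := by
    intro n n' hn
    simp only at hn
    rw [← sub_eq_zero, ← map_sub, ← intVec_sub, Submodule.projection_apply_eq_zero_iff] at hn
    obtain ⟨t, ht⟩ := Submodule.mem_span_singleton.1 hn
    have h1 := congrFun ht (Fin.last d)
    have h2 := congrFun ht (Fin.castSucc ⟨0, hd⟩)
    rw [Pi.smul_apply, graphNormal_last, smul_eq_mul, mul_one] at h1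
    rw [Pi.smul_apply, graphNormal_castSucc, smul_eq_mul] at h2
    -- An integer multiple `t` of the normal vector with `t * α 0` integral must be zero.
    have hz : (n - n') (Fin.last d) = 0 := by
      by_contra hz
      refine hα (Pi.single ⟨0, hd⟩ ((n - n') (Fin.last d)))
        (by rwa [Ne, Pi.single_eq_zero_iff]) (-(n - n') (Fin.castSucc ⟨0, hd⟩)) ?_
      rw [sum_single_mul]
      simp only [intVec] at h1 h2
      rw [Int.cast_neg, ← h1, ← h2]
      ring
    have ht0 : t = 0 := by
      rw [h1, intVec, hz, Int.cast_zero]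
    rw [ht0, zero_smul, ← intVec_zero] at ht
    exact sub_eq_zero.1 (intVec_injective ht).symm

lemma irrational_of_forall_sum_ne
    (hα : ∀ u : Fin d → ℤ, u ≠ 0 → ∀ z : ℤ, ∑ i, u i * α i ≠ z) (i : Fin d) : Irrational (α i) := by
  rintro ⟨r, hr⟩
  refine hα (Pi.single i (r.den : ℤ)) ?_ r.num ?_
  · rw [Ne, Pi.single_eq_zero_iff]
    exact_mod_cast r.den_ne_zero
  · rw [sum_single_mul, ← hr]
    exact_mod_cast Rat.den_mul_eq_num r

variable (hd : 1 ≤ d) (hα : ∀ u : Fin d → ℤ, u ≠ 0 → ∀ z : ℤ, ∑ i, u i * α i ≠ z) (σ : ℝ)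

lemma mem_strip_graphData_iff (v : Fin (d + 1) → ℝ) :
    v ∈ (graphData α hd hα σ).strip ↔ graphForm α v ∈ Set.Ico 0 1 := by
  constructor
  · rintro ⟨w, ⟨-, hw⟩, e, he, rfl⟩
    have he : graphForm α e = 0 := he
    simpa [he] using hw
  · intro hv
    have hpos := graphForm_graphNormal_pos α
    have he : graphForm α ((graphForm α v / graphForm α (graphNormal α)) • graphNormal α) =
        graphForm α v := by
      rw [map_smul, smul_eq_mul, div_mul_cancel₀ _ hpos.ne']
    refine ⟨(graphForm α v / graphForm α (graphNormal α)) • graphNormal α, ⟨?_, ?_⟩,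
      v - (graphForm α v / graphForm α (graphNormal α)) • graphNormal α, ?_, by simp⟩
    · exact Submodule.smul_mem _ _ (Submodule.mem_span_singleton_self _)
    · rw [he]; exact hv
    · change graphForm α _ = 0
      rw [map_sub, he, sub_self]

lemma strip_inter_ref_graphData :
    (graphData α hd hα σ).strip ∩ (refSubspace (d + 1) d : Set (Fin (d + 1) → ℝ)) =
      cubicalWindow (d + 1) d := by
  ext v
  rw [Set.mem_inter_iff, mem_strip_graphData_iff]
  constructor
  · rintro ⟨h1, h2⟩ i
    refine ⟨fun hi => h2 i hi, fun hi => ?_⟩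
    have : i = Fin.last d := Fin.ext (by have := i.2; simp; omega)
    rw [this, ← graphForm_of_mem_ref α h2]
    exact h1
  · intro hv
    have h2 : v ∈ refSubspace (d + 1) d := fun i hi => (hv i).1 hi
    refine ⟨?_, h2⟩
    rw [graphForm_of_mem_ref α h2]
    exact (hv (Fin.last d)).2 le_rfl

lemma coeff_graphData (i : Fin d) : (graphData α hd hα σ).coeff (Fin.last d) i = α i := by
  set D := graphData α hd hα σ with hD
  set v : Fin (d + 1) → ℝ := embed (d + 1) d (Pi.single i 1) with hv
  have h1 : D.coeff (Fin.last d) i = D.rho v (Fin.last d) := rfl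
  have h2 : graphForm α (D.rho v) = 0 := D.rho_mem v
  rw [graphForm_apply, sub_eq_zero] at h2
  rw [h1, h2, Finset.sum_eq_single i]
  · rw [D.rho_apply_of_lt v (i := Fin.castSucc i) i.2, hv, embed_of_lt _ (i := Fin.castSucc i) i.2]
    simp
  · intro l _ hl
    rw [D.rho_apply_of_lt v (i := Fin.castSucc l) l.2, hv, embed_of_lt _ (i := Fin.castSucc l) l.2]
    simp [hl]
  · simp

lemma graphForm_intVec (n : Fin (d + 1) → ℤ) :
    graphForm α (intVec n) = n (Fin.last d) - ∑ i, (n (Fin.castSucc i) : ℝ) * α i := by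
  rw [graphForm_apply]
  simp only [intVec, mul_comm]

lemma graphForm_s : graphForm α (graphData α hd hα σ).s = σ := by
  rw [graphForm_apply]
  simp [graphData, Fin.castSucc_ne_last]

/-- On the boundary `graphForm` is `0` or `1`; at translated integer points this would write `σ` as
an excluded sum. -/
lemma isRegular_graphData (hσ : ∀ (u : Fin d → ℤ) (z : ℤ), ∑ i, u i * α i + z ≠ σ) :
    (graphData α hd hα σ).IsRegular := by
  intro n hn
  have hcont : Continuous (graphForm α) := LinearMap.continuous_of_finiteDimensional _
  have hpre : (graphData α hd hα σ).strip = graphForm α ⁻¹' Set.Ico 0 1 :=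
    Set.ext fun v => mem_strip_graphData_iff α hd hα σ v
  rw [hpre] at hn
  have h1 := hcont.frontier_preimage_subset _ hn
  rw [Set.mem_preimage, frontier_Ico zero_lt_one, map_add, graphForm_s, graphForm_intVec] at h1
  rcases h1 with h1 | h1
  · exact hσ (fun i => n (Fin.castSucc i)) (-n (Fin.last d)) (by
      push_cast
      linarith)
  · exact hσ (fun i => n (Fin.castSucc i)) (1 - n (Fin.last d)) (by
      push_cast
      have h2 : (n (Fin.last d) : ℝ) - ∑ i, (n (Fin.castSucc i) : ℝ) * α i + σ = 1 := h1
      linarith)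

/-- One irrational coefficient suffices: fix the first `d` coordinates modulo `1`, then shift the
first of them by integers `t`, which moves the last coordinate by the dense multiples `t * α 0`. -/
lemma isTotallyIrrational_graphData : (graphData α hd hα σ).IsTotallyIrrational := by
  refine Metric.dense_iff.2 fun y ε hε => ?_
  choose τ hτ using fun i => QuotientAddGroup.mk_surjective (y i)
  have hirr := irrational_of_forall_sum_ne α hα ⟨0, hd⟩
  have hdense : DenseRange fun t : ℤ => t • ((α ⟨0, hd⟩ : ℝ) : UnitAddCircle) := by
    rw [AddCircle.denseRange_zsmul_coe_iff, div_one]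
    exact hirr
  set S := ∑ i, α i * τ (Fin.castSucc i) with hS
  obtain ⟨t, ht⟩ := hdense.exists_dist_lt (y (Fin.last d) - (S : UnitAddCircle)) hε
  set e : Fin (d + 1) → ℝ := Fin.snoc (α := fun _ => ℝ)
    (fun i => τ (Fin.castSucc i) + if i = ⟨0, hd⟩ then (t : ℝ) else 0) (S + t * α ⟨0, hd⟩) with he
  refine ⟨_, ?_, e, ?_, rfl⟩
  · rw [Metric.mem_ball, dist_pi_lt_iff hε]
    intro i
    refine Fin.lastCases ?_ (fun i => ?_) i
    · simp only [he, Fin.snoc_last]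
      rw [dist_comm, AddCircle.coe_add]
      have h1 : ((t * α ⟨0, hd⟩ : ℝ) : UnitAddCircle) = t • ((α ⟨0, hd⟩ : ℝ) : UnitAddCircle) := by
        rw [← zsmul_eq_mul, AddCircle.coe_zsmul]
      rw [h1, dist_eq_norm, ← sub_sub, ← dist_eq_norm]
      exact ht
    · have h1 : ((e (Fin.castSucc i) : ℝ) : UnitAddCircle) = y (Fin.castSucc i) := by
        rw [← hτ]
        simp only [he, Fin.snoc_castSucc]
        split_ifs
        · rw [AddCircle.coe_add, ← zsmul_one, AddCircle.coe_zsmul, AddCircle.coe_period, smul_zero,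
            add_zero]
        · rw [add_zero]
      simp only [h1, dist_self]
      exact hε
  · change graphForm α e = 0
    rw [graphForm_apply]
    simp only [he, Fin.snoc_last, Fin.snoc_castSucc, mul_add, Finset.sum_add_distrib, ← hS]
    simp [mul_comm]

/-- A period lifts to one integer vector `v`, the same at every point by injectivity. Adding `v`
repeatedly stays in the strip, so `graphForm` vanishes on `v`, and independence of `α` gives `v =
0`. -/
lemma isAperiodic_graphData : (graphData α hd hα σ).IsAperiodic := by
  set D := graphData α hd hα σ with hD
  have h : d ≤ d + 1 := Nat.le_succ d
  have hc := strip_inter_ref_graphData α hd hα σ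
  rw [← hD] at hc
  intro x _ hper
  rw [D.pointSet_eq_range h hc] at hper
  have hstep : ∀ m, ∃ m', D.pointOf h m' = D.pointOf h m + x := by
    intro m
    have : D.pointOf h m + x ∈ (fun y => y + x) '' Set.range (D.pointOf h) := ⟨_, ⟨m, rfl⟩, rfl⟩
    rw [hper] at this
    exact this
  obtain ⟨m₀, hm₀⟩ := hstep 0
  have hx : ∀ m m', D.pointOf h m' = D.pointOf h m + x →
      D.proj (intVec (D.liftOf h m' - D.liftOf h m)) = x := by
    intro m m' hmm
    rw [intVec_sub, map_sub]
    simp only [Data.pointOf, map_add] at hmm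
    rw [sub_eq_iff_eq_add, ← add_left_inj (D.proj D.s), hmm]
    abel
  set v := D.liftOf h m₀ - D.liftOf h 0 with hv
  have hiter : ∀ t : ℕ, ∃ m, D.liftOf h m = D.liftOf h 0 + t • v := by
    intro t
    induction t with
    | zero => exact ⟨0, by simp⟩
    | succ t ih =>
      obtain ⟨m, hm⟩ := ih
      obtain ⟨m', hm'⟩ := hstep m
      have := D.eq_of_proj_intVec_eq ((hx _ _ hm').trans (hx _ _ hm₀).symm)
      refine ⟨m', ?_⟩
      rw [sub_eq_iff_eq_add.1 this, hm, succ_nsmul, ← hv]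
      abel
  have hform : ∀ t : ℕ, graphForm α (intVec (D.liftOf h 0) + D.s) + t * graphForm α (intVec v) ∈
      Set.Ico (0 : ℝ) 1 := by
    intro t
    obtain ⟨m, hm⟩ := hiter t
    have h1 := (mem_strip_graphData_iff α hd hα σ _).1 (D.intVec_liftOf_mem_strip h hc m)
    have h2 : intVec (t • v) = (t : ℝ) • intVec v := by
      funext i
      simp [intVec]
    rw [hm, intVec_add, h2, map_add, map_add, map_smul, smul_eq_mul] at h1
    rw [map_add, add_right_comm]
    exact h1
  have hzero : graphForm α (intVec v) = 0 := by
    by_contra hne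
    obtain ⟨t, ht⟩ := exists_nat_gt (1 / |graphForm α (intVec v)|)
    rw [div_lt_iff₀ (abs_pos.2 hne)] at ht
    have h0 := hform 0
    have h1 := hform t
    rw [Nat.cast_zero, zero_mul, add_zero] at h0
    rcases abs_cases (graphForm α (intVec v)) with ⟨h2, -⟩ | ⟨h2, -⟩ <;> rw [h2] at ht <;>
      linarith [h0.1, h0.2, h1.1, h1.2]
  rw [graphForm_intVec, sub_eq_zero] at hzero
  have hhead : (fun i => v (Fin.castSucc i)) = 0 := by
    by_contra hne
    exact hα _ hne _ hzero.symm
  have hv0 : v = 0 := by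
    funext i
    refine Fin.lastCases ?_ (fun i => congrFun hhead i) i
    have : ∀ i, v (Fin.castSucc i) = 0 := fun i => congrFun hhead i
    simp only [this, Int.cast_zero, zero_mul, Finset.sum_const_zero] at hzero
    exact_mod_cast hzero
  rw [← hx _ _ hm₀, ← hv, hv0, intVec_zero, map_zero]

end Construction

lemma exists_forall_sum_add_ne {d : ℕ} (α : Fin d → ℝ) :
    ∃ σ : ℝ, ∀ (u : Fin d → ℤ) (z : ℤ), ∑ i, u i * α i + z ≠ σ := by
  have hcount : (Set.range fun x : (Fin d → ℤ) × ℤ => ∑ i, (x.1 i : ℝ) * α i + x.2).Countable :=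
    Set.countable_range _
  obtain ⟨σ, hσ⟩ : (Set.range fun x : (Fin d → ℤ) × ℤ =>
      ∑ i, (x.1 i : ℝ) * α i + x.2)ᶜ.Nonempty := by
    rw [Set.nonempty_compl]
    intro h
    rw [h] at hcount
    exact Set.not_countable_univ hcount
  exact ⟨σ, fun u z h => hσ ⟨(u, z), h⟩⟩

lemma exists_isLRWith_of_isBadLinearForm {d : ℕ} (hd : 1 ≤ d) {α : Fin d → ℝ} {c : ℝ}
    (hc : 0 < c) (hbad : IsBadLinearForm α c) :
    ∃ D : Data (d + 1) d, D.IsCubical ∧ D.IsLRWith (alignedRectangles d) := by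
  have hα : ∀ u : Fin d → ℤ, u ≠ 0 → ∀ z : ℤ, ∑ i, u i * α i ≠ z := by
    intro u hu z hz
    have h1 := hbad u hu
    have h2 : distInt (∑ i, (u i : ℝ) * α i) = 0 := by
      rw [hz]
      simp [distInt]
    rw [h2, mul_zero] at h1
    linarith
  obtain ⟨σ, hσ⟩ := exists_forall_sum_add_ne α
  have hw := strip_inter_ref_graphData α hd hα σ
  refine ⟨graphData α hd hα σ, ⟨isRegular_graphData α hd hα σ hσ,
    isTotallyIrrational_graphData α hd hα σ, isAperiodic_graphData α hd hα σ, hw⟩, ?_⟩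
  have hcoeff : (graphData α hd hα σ).coeff (Fin.last d) = α :=
    funext fun i => coeff_graphData α hd hα σ i
  obtain ⟨A, hA, hR⟩ := (graphData α hd hα σ).exists_recursWith_of_isBadLinearForm
    (Nat.le_succ d) hd (j := Fin.last d)
    (fun j' hj' => Fin.ext (by have := j'.2; simp; omega)) hc (hcoeff.symm ▸ hbad)
  exact (graphData α hd hα σ).isLRWith_of_recursWith (Nat.le_succ d) hd hw hA hR

/-! ### The Diophantine condition as a lower limit -/

lemma liminf_pos_of_isBadTuple {d : ℕ} {α : Fin d → ℝ} {c : ℝ} (hc : 0 < c)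
    (h : IsBadTuple α c) :
    (0 : EReal) < Filter.liminf
      (fun n : ℕ => (((n : ℝ) * ∏ i, distInt ((n : ℝ) * α i) : ℝ) : EReal)) Filter.atTop := by
  refine lt_of_lt_of_le (EReal.coe_pos.2 hc) (Filter.le_liminf_of_le (by isBoundedDefault) ?_)
  filter_upwards [Filter.eventually_ge_atTop 1] with n hn
  exact EReal.coe_le_coe_iff.2 (h n hn)

/-- A zero value at one `n` would recur at its multiples, beyond the threshold `N`; so the finitely
many small `n` have a positive minimum. -/
lemma exists_isBadTuple_of_liminf_pos {d : ℕ} {α : Fin d → ℝ}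
    (h : (0 : EReal) < Filter.liminf
      (fun n : ℕ => (((n : ℝ) * ∏ i, distInt ((n : ℝ) * α i) : ℝ) : EReal)) Filter.atTop) :
    ∃ c : ℝ, 0 < c ∧ IsBadTuple α c := by
  obtain ⟨c, hc0, hc⟩ := EReal.lt_iff_exists_real_btwn.1 h
  have hc0 : 0 < c := EReal.coe_pos.1 hc0
  obtain ⟨N, hN⟩ := Filter.eventually_atTop.1 (Filter.eventually_lt_of_lt_liminf hc)
  have hN' : ∀ n ≥ N, c < n * ∏ i, distInt (n * α i) := fun n hn => EReal.coe_lt_coe_iff.1 (hN n hn)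
  have hpos : ∀ n : ℕ, 1 ≤ n → 0 < n * ∏ i, distInt (n * α i) := by
    intro n hn
    refine mul_pos (by exact_mod_cast hn) (Finset.prod_pos fun i _ => ?_)
    refine lt_of_le_of_ne (distInt_nonneg _) fun h0 => ?_
    have hz : n * α i = round (n * α i) := sub_eq_zero.1 (abs_eq_zero.1 h0.symm)
    have h1 : distInt (((n * (N + 1) : ℕ) : ℝ) * α i) = 0 := by
      have e : ((n * (N + 1) : ℕ) : ℝ) * α i = ((round (n * α i) * (N + 1) : ℤ) : ℝ) := by
        push_cast
        rw [← hz]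
        ring
      rw [e, distInt, round_intCast, sub_self, abs_zero]
    have h2 := hN' (n * (N + 1)) (by nlinarith)
    rw [Finset.prod_eq_zero (Finset.mem_univ i) h1, mul_zero] at h2
    linarith
  obtain ⟨n₀, hn₀, hmin⟩ := Finset.exists_min_image (Finset.Icc 1 (N + 1))
    (fun n : ℕ => (n : ℝ) * ∏ i, distInt (n * α i)) ⟨1, by simp⟩
  refine ⟨min c (n₀ * ∏ i, distInt (n₀ * α i)),
    lt_min hc0 (hpos n₀ (Finset.mem_Icc.1 hn₀).1), fun n hn => ?_⟩
  by_cases hnN : N ≤ n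
  · exact (min_le_left _ _).trans (hN' n hnN).le
  · exact (min_le_right _ _).trans (hmin n (Finset.mem_Icc.2 ⟨hn, by omega⟩))

end CutProject

end

/-! ### The theorem -/

theorem theorem1p2 (k d : ℕ) (hd : 1 ≤ d) (hkd : d < k) :
    (1 < k - d →
      ¬ ∃ D : CutProject.Data k d,
        D.IsCubical ∧ D.IsLRWith (CutProject.alignedRectangles d)) ∧
    (k - d = 1 →
      ((∃ D : CutProject.Data k d,
          D.IsCubical ∧ D.IsLRWith (CutProject.alignedRectangles d)) ↔
        ∃ α : Fin d → ℝ,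
          (0 : EReal) < Filter.liminf
            (fun n : ℕ => (((n : ℝ) * ∏ i, CutProject.distInt ((n : ℝ) * α i) : ℝ) : EReal))
            Filter.atTop)) := by
  refine ⟨fun h1 ⟨D, hD, hLR⟩ => D.not_isLRWith_of_one_lt hd h1 hD hLR, fun h1 => ?_⟩
  obtain rfl : k = d + 1 := by omega
  constructor
  · rintro ⟨D, ⟨-, hirr, hap, hc⟩, hLR⟩
    obtain ⟨A, hA, hR⟩ := D.exists_recursWith (Nat.le_succ d) hd hc hLR
    have hbad := hR.isBadLinearForm hd hirr hap hc (j := Fin.last d) le_rfl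
      (fun j' hj' => Fin.ext (by have := j'.2; simp; omega)) hA
    have hd0 : (0 : ℝ) < d := by exact_mod_cast hd
    exact ⟨_, CutProject.liminf_pos_of_isBadTuple (by positivity)
      (hbad.isBadTuple hd (by positivity))⟩
  · rintro ⟨α, hα⟩
    obtain ⟨c, hc, hbad⟩ := CutProject.exists_isBadTuple_of_liminf_pos hα
    obtain ⟨c', hc', hbad'⟩ := hbad.exists_isBadLinearForm hc
    exact CutProject.exists_isLRWith_of_isBadLinearForm hd hc' hbad'
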